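/- Let $n\ge 1$ items ranked $1,\dots,n$ from best to worst arrive at independent times, uniformly distributed on $[0,1]$. Pierre chooses $n$; his mixed strategies are the probability distributions $\nu=(\nu_1,\nu_2,\dots)$ on the positive integers. Alice does not know $n$. She observes the arrivals in chronological order, together with the rank of each arrival relative to those seen so far; an arrival of relative rank $1$ is called a record. Her strategies $\tau$ are the (measurable) stopping rules that stop at one of the records or not at all, the decision at each arrival depending only on the arrival times and relative ranks observed up to that moment. Alice wins if she stops at the best of all $n$ items, equivalently at the last record. Let $W(\tau,n)$ be the probability of this event and $W(\tau,\nu)=\sum_{n\ge1}\nu_n W(\tau,n)$ the payoff of the game, which Alice maximizes and Pierre minimizes. For $0\le x\le 1$ let $\tau_x$ (the $x$-strategy) be the strategy that stops at the first record arriving at time $x$ or later. Then: (i) the value of the game is $1/e$: $$\sup_\tau\inf_\nu W(\tau,\nu)=\inf_\nu\sup_\tau W(\tau,\nu)=\frac1e;$$ (ii) Pierre has no minimax strategy, i.e. $\inf_\nu\sup_\tau W(\tau,\nu)$ is not attained by any $\nu$; and the game has no saddle point, i.e. there is no pair $(\tau,\nu)$ with $W(\tau',\nu)\le W(\tau,\nu)\le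 W(\tau,\nu')$ for all $\tau',\nu'$; (iii) for no distribution $\nu$ on the positive integers is the $1/e$-strategy $\tau_{1/e}$ $\nu$-optimal, i.e. a maximizer of $W(\cdot,\nu)$; indeed, for every $\nu$ there is an $x\in[0,1]$ with $W(\tau_x,\nu)>W(\tau_{1/e},\nu)$. Parts (i) and (ii) hold also if Alice may randomize, that is, if $\tau$ is replaced by a stopping rule depending measurably on a seed that is uniform on $[0,1]$ and independent of everything else. -/

import Mathlib

open MeasureTheory
open scoped ENNReal

noncomputable section

/-! ### Two-person zero-sum games

`W a b` is the payoff received by the maximizer playing `a` from the minimizer playing `b`. -/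

section Games

variable {A B : Type*}

/-- The payoff that the maximizer can guarantee. -/
def lowerValue (W : A → B → ℝ≥0∞) : ℝ≥0∞ := ⨆ a, ⨅ b, W a b

/-- The payoff to which the minimizer can hold the maximizer down. -/
def upperValue (W : A → B → ℝ≥0∞) : ℝ≥0∞ := ⨅ b, ⨆ a, W a b

/-- The game has the value `v`. -/
def HasValue (W : A → B → ℝ≥0∞) (v : ℝ≥0∞) : Prop :=
  lowerValue W = v ∧ upperValue W = v

/-- `b` is a minimax strategy of the minimizer: it minimizes the largest payoff that the maximizer
can achieve against it. -/
def IsMinimax (W : A → B → ℝ≥0∞) (b : B) : Prop :=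
  ∀ b', (⨆ a, W a b) ≤ ⨆ a, W a b'

/-- `(a, b)` is a saddle point: each of `a` and `b` is a best response to the other. -/
def IsSaddlePoint (W : A → B → ℝ≥0∞) (a : A) (b : B) : Prop :=
  (∀ a', W a' b ≤ W a b) ∧ ∀ b', W a b ≤ W a b'

end Games

/-! ### The random arrivals

The items are labelled by their absolute ranks, `0 : Fin n` being the best, and `u i` is the
arrival time of the item `i`. -/

/-- The joint law of the arrival times of `n` items: independent and uniform on `[0, 1]`. -/
def arrivalLaw (n : ℕ) : Measure (Fin n → ℝ) :=
  Measure.pi fun _ => volume.restrict (Set.Icc (0 : ℝ) 1)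

/-- The item that comes in position `k` of the chronological order (positions are counted from
`0`). -/
def itemAt {n : ℕ} (u : Fin n → ℝ) (k : Fin n) : Fin n := Tuple.sort u k

/-- The time of the arrival in position `k`. -/
def arrivalTime {n : ℕ} (u : Fin n → ℝ) (k : Fin n) : ℝ := u (itemAt u k)

/-- The relative rank of the arrival in position `k` among the arrivals up to and including
position `k`; it is `1` if and only if this arrival is a record. -/
def relRank {n : ℕ} (u : Fin n → ℝ) (k : Fin n) : ℕ :=
  (Finset.univ.filter fun j : Fin n => j ≤ k ∧ itemAt u j ≤ itemAt u k).card

/-! ### The strategies and the winning probability -/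

/-- A (pure) stopping strategy of Alice. From the arrival times `t` in chronological order and the
relative ranks `r` of all `n` items it chooses the position of an arrival, or `none` (no stop). -/
structure StoppingStrategy where
  choice : (n : ℕ) → (Fin n → ℝ) → (Fin n → ℕ) → Option (Fin n)
  /-- The choice is a measurable function of the data. -/
  measurable_choice : ∀ (n : ℕ) (k : Fin n),
    MeasurableSet {d : (Fin n → ℝ) × (Fin n → ℕ) | choice n d.1 d.2 = some k}
  /-- If an arrival is chosen, then it is also chosen for every other number of items and all other
  data that agree with the given ones up to and including this arrival. -/
  nonanticipating : ∀ (k m n : ℕ) (hm : k < m) (hn : k < n) (t : Fin m → ℝ) (r : Fin m → ℕ)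
    (t' : Fin n → ℝ) (r' : Fin n → ℕ),
    (∀ (j : ℕ) (hj : j ≤ k), t ⟨j, hj.trans_lt hm⟩ = t' ⟨j, hj.trans_lt hn⟩ ∧
      r ⟨j, hj.trans_lt hm⟩ = r' ⟨j, hj.trans_lt hn⟩) →
    choice m t r = some ⟨k, hm⟩ → choice n t' r' = some ⟨k, hn⟩
  /-- Only records can be chosen. -/
  record : ∀ (n : ℕ) (t : Fin n → ℝ) (r : Fin n → ℕ) (k : Fin n), choice n t r = some k → r k = 1

/-- Alice wins if she stops at an arrival that is the last record. -/
def winEvent (τ : StoppingStrategy) (n : ℕ) : Set (Fin n → ℝ) :=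
  {u | ∃ k : Fin n, τ.choice n (arrivalTime u) (relRank u) = some k ∧ relRank u k = 1 ∧
    ∀ j : Fin n, k < j → 1 < relRank u j}

/-- The winning probability of `τ` when the number of items is `n`. -/
def winProbAt (τ : StoppingStrategy) (n : ℕ) : ℝ≥0∞ := arrivalLaw n (winEvent τ n)

/-- The winning probability of `τ` when Pierre plays the mixed strategy `ν`, a probability
distribution of the number of items on the positive integers. -/
def winProb (τ : StoppingStrategy) (ν : PMF ℕ+) : ℝ≥0∞ :=
  ∑' n : ℕ+, ν n * winProbAt τ n

/-- `τ` achieves the maximal winning probability against `ν`. -/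
def IsOptimalAgainst (ν : PMF ℕ+) (τ : StoppingStrategy) : Prop :=
  ∀ τ', winProb τ' ν ≤ winProb τ ν

/-- A randomized strategy of Alice: a stopping strategy that depends measurably on a random seed,
which is uniform on `[0, 1]` and independent of everything else. -/
structure RandomizedStrategy where
  strategy : ℝ → StoppingStrategy
  measurable_strategy : ∀ (n : ℕ) (k : Fin n),
    MeasurableSet {d : ℝ × (Fin n → ℝ) × (Fin n → ℕ) |
      (strategy d.1).choice n d.2.1 d.2.2 = some k}

/-- The winning probability of a randomized strategy of Alice against `ν`. -/
def randomizedWinProb (σ : RandomizedStrategy) (ν : PMF ℕ+) : ℝ≥0∞ :=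
  ∫⁻ s in Set.Icc (0 : ℝ) 1, winProb (σ.strategy s) ν

open Classical in
/-- The choice made by the `x`-strategy: the first record that arrives at time `x` or later. -/
def xChoice (x : ℝ) (n : ℕ) (t : Fin n → ℝ) (r : Fin n → ℕ) : Option (Fin n) :=
  Fin.find? fun k => decide (x ≤ t k ∧ r k = 1)

theorem xChoice_eq_some_iff (x : ℝ) (n : ℕ) (t : Fin n → ℝ) (r : Fin n → ℕ) (k : Fin n) :
    xChoice x n t r = some k ↔
      (x ≤ t k ∧ r k = 1) ∧ ∀ j : Fin n, j < k → ¬ (x ≤ t j ∧ r j = 1) := by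
  unfold xChoice
  rw [Fin.find?_eq_some_iff]
  simp only [decide_eq_true_eq, decide_eq_false_iff_not]

/-- The `x`-strategy: stop at the first record that arrives at time `x` or later. -/
def xStrategy (x : ℝ) : StoppingStrategy where
  choice := xChoice x
  measurable_choice n k := by
    have hm : ∀ j : Fin n, MeasurableSet
        {d : (Fin n → ℝ) × (Fin n → ℕ) | x ≤ d.1 j ∧ d.2 j = 1} := fun j =>
      (measurableSet_le measurable_const ((measurable_pi_apply j).comp measurable_fst)).inter
        (((measurable_pi_apply j).comp measurable_snd) (measurableSet_singleton 1))
    have he : {d : (Fin n → ℝ) × (Fin n → ℕ) | xChoice x n d.1 d.2 = some k} =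
        {d | x ≤ d.1 k ∧ d.2 k = 1} ∩
          ⋂ j : Fin n, ⋂ _ : j < k, {d | x ≤ d.1 j ∧ d.2 j = 1}ᶜ := by
      ext d
      simp only [Set.mem_inter_iff, Set.mem_iInter, Set.mem_compl_iff]
      exact xChoice_eq_some_iff x n d.1 d.2 k
    rw [he]
    exact (hm k).inter (MeasurableSet.iInter fun j => MeasurableSet.iInter fun _ => (hm j).compl)
  nonanticipating k m n hm hn t r t' r' h hk := by
    rw [xChoice_eq_some_iff] at hk ⊢
    refine ⟨?_, fun j hj => ?_⟩
    · rw [← (h k le_rfl).1, ← (h k le_rfl).2]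
      exact hk.1
    · have hjk : (j : ℕ) < k := hj
      have := hk.2 ⟨j, hjk.trans hm⟩ hjk
      rw [(h j hjk.le).1, (h j hjk.le).2] at this
      exact this
  record n t r k h := ((xChoice_eq_some_iff x n t r k).1 h).1.2

end

/-! Lower bound. With `m + 1` items the `x`-strategy wins with probability `xWin m x`, which
decreases strictly in `m` to `-x log x` (`xWin_strictAnti`, `tendsto_xWin`). For `x = 1/e` the limit
is `1/e`, so the `1/e`-strategy wins with probability above `1/e` against every `ν`
(`one_div_exp_lt_winProb`).

Upper bound. Let Pierre play a geometric law with parameter `q` near `1`, and suppose first that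
having no items is allowed. Then, with `z(t) = 1 - q + q t`, records occur at rate `q / z(t)`
whatever the past. Hence a strategy matters only through its `stopRate` `φ(t)`, the probability of
stopping at a record given that one occurs at `t`. Stopping before `s` and stopping at `s` exclude
each other, so `φ(s) + ∫_0^s (q / z) φ ≤ 1` (`stopRate_add_lintegral_le`). Under this constraint `q
∫ φ`, which bounds the winning probability, is at most `1/e`: this is a linear program, and the
positive part of `q (1 + log z)` is a dual certificate (`lintegral_stopping_bound`). Conditioning on
at least one item divides by `q` (`winProb_geomPMF_le_one_div`), and `q → 1` gives the upper value.

No minimax strategy, no saddle point. The upper value is `1/e`, yet every `ν` concedes strictly more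
than `1/e`; in a saddle point Pierre's strategy would be minimax.

The `1/e`-strategy is never optimal. Each `xWin m` is concave on `[0, 1]` with negative slope at
`1/e`, so a slightly smaller `x` helps against each single `n`. The bound `xSlope_lt`, uniform in
`m`, makes one `x` work for the whole mixture (`exists_winProb_xStrategy_gt`). -/

/-! ### The chronological order -/

section Order

variable {n : ℕ} {u : Fin n → ℝ}

theorem arrivalTime_strictMono (hu : Function.Injective u) : StrictMono (arrivalTime u) :=
  (Tuple.monotone_sort u).strictMono_of_injective (hu.comp (Tuple.sort u).injective)

theorem exists_itemAt_eq (u : Fin n → ℝ) (i : Fin n) : ∃ k, itemAt u k = i :=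
  (Tuple.sort u).surjective i

theorem card_lt_itemAt (hu : Function.Injective u) (p : Fin n) :
    (Finset.univ.filter fun j => u j < u (itemAt u p)).card = p := by
  have : (Finset.univ.filter fun j => u j < u (itemAt u p)) =
      (Finset.Iio p).map (Tuple.sort u).toEmbedding := by
    ext j
    obtain ⟨l, rfl⟩ := exists_itemAt_eq u j
    have h1 : u (itemAt u l) < u (itemAt u p) ↔ l < p := (arrivalTime_strictMono hu).lt_iff_lt
    have h2 : (Tuple.sort u).symm (itemAt u l) = l := (Tuple.sort u).symm_apply_apply l
    simp only [Finset.mem_filter, Finset.mem_univ, true_and, h1, Finset.mem_map_equiv, h2,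
      Finset.mem_Iio]
  rw [this, Finset.card_map, Fin.card_Iio]

theorem itemAt_eq_of_card (hu : Function.Injective u) (i k : Fin n)
    (h : (Finset.univ.filter fun j => u j < u i).card = k) : itemAt u k = i := by
  obtain ⟨p, rfl⟩ := exists_itemAt_eq u i
  rw [card_lt_itemAt hu] at h
  rw [Fin.ext h]

theorem relRank_eq_one_iff (u : Fin n → ℝ) (k : Fin n) :
    relRank u k = 1 ↔ ∀ j < k, itemAt u k < itemAt u j := by
  have hk : k ∈ Finset.univ.filter fun j : Fin n => j ≤ k ∧ itemAt u j ≤ itemAt u k := by simp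
  rw [relRank, Finset.card_eq_one]
  constructor
  · rintro ⟨a, ha⟩ j hj
    by_contra! hle
    have h1 : j ∈ Finset.univ.filter fun j : Fin n => j ≤ k ∧ itemAt u j ≤ itemAt u k := by
      simp [hj.le, hle]
    rw [ha, Finset.mem_singleton] at h1 hk
    exact hj.ne (h1.trans hk.symm)
  · intro h
    refine ⟨k, Finset.eq_singleton_iff_unique_mem.2 ⟨hk, fun j hj => ?_⟩⟩
    simp only [Finset.mem_filter, Finset.mem_univ, true_and] at hj
    by_contra hne
    exact absurd (h j (lt_of_le_of_ne hj.1 hne)) hj.2.not_gt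

theorem relRank_pos (u : Fin n → ℝ) (k : Fin n) : 0 < relRank u k :=
  Finset.card_pos.2 ⟨k, by simp⟩

/-- An arrival is a record if and only if all earlier items are worse. -/
theorem relRank_eq_one_iff_items (hu : Function.Injective u) (k : Fin n) :
    relRank u k = 1 ↔ ∀ i, u i < arrivalTime u k → itemAt u k < i := by
  rw [relRank_eq_one_iff]
  constructor
  · intro h i hi
    obtain ⟨j, rfl⟩ := exists_itemAt_eq u i
    exact h j ((arrivalTime_strictMono hu).lt_iff_lt.1 hi)
  · intro h j hj
    exact h _ (arrivalTime_strictMono hu hj)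

/-- The first arrivals are determined by the items that arrive first. -/
theorem itemAt_comp (hu : Function.Injective u) {m : ℕ} (e : Fin m ↪o Fin n) (hm : m ≤ n)
    (he : ∀ i ∉ Set.range e, ∀ j, u (e j) < u i) (k : Fin m) :
    itemAt u (Fin.castLE hm k) = e (itemAt (u ∘ e) k) := by
  apply itemAt_eq_of_card hu
  have h := card_lt_itemAt (hu.comp e.injective) k
  rw [Fin.val_castLE, ← h, ← Finset.card_map e.toEmbedding]
  congr 1
  ext i
  simp only [Finset.mem_filter, Finset.mem_univ, true_and, Finset.mem_map, Function.comp_apply]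
  constructor
  · intro hi
    by_cases hr : i ∈ Set.range e
    · obtain ⟨j, rfl⟩ := hr
      exact ⟨j, hi, rfl⟩
    · exact absurd (he i hr _) hi.not_gt
  · rintro ⟨j, hj, rfl⟩
    exact hj

theorem arrivalTime_comp (hu : Function.Injective u) {m : ℕ} (e : Fin m ↪o Fin n) (hm : m ≤ n)
    (he : ∀ i ∉ Set.range e, ∀ j, u (e j) < u i) (k : Fin m) :
    arrivalTime u (Fin.castLE hm k) = arrivalTime (u ∘ e) k := by
  rw [arrivalTime, itemAt_comp hu e hm he]
  rfl

theorem relRank_comp (hu : Function.Injective u) {m : ℕ} (e : Fin m ↪o Fin n) (hm : m ≤ n)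
    (he : ∀ i ∉ Set.range e, ∀ j, u (e j) < u i) (k : Fin m) :
    relRank u (Fin.castLE hm k) = relRank (u ∘ e) k := by
  rw [relRank, relRank, ← Finset.card_map (Fin.castLEEmb hm)]
  congr 1
  ext i
  simp only [Finset.mem_filter, Finset.mem_univ, true_and, Finset.mem_map, Fin.coe_castLEEmb]
  constructor
  · rintro ⟨h1, h2⟩
    have hi : (i : ℕ) < m := lt_of_le_of_lt h1 k.2
    have : i = Fin.castLE hm ⟨i, hi⟩ := rfl
    rw [this, itemAt_comp hu e hm he, itemAt_comp hu e hm he, e.le_iff_le] at h2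
    exact ⟨⟨i, hi⟩, ⟨h1, h2⟩, rfl⟩
  · rintro ⟨j, ⟨h1, h2⟩, rfl⟩
    rw [itemAt_comp hu e hm he, itemAt_comp hu e hm he, e.le_iff_le]
    exact ⟨h1, h2⟩

end Order

namespace StoppingStrategy

variable (τ : StoppingStrategy)

/-- Nonanticipation does not ask which of the two item numbers is larger, so it can be applied in
both directions. -/
theorem choice_eq_some_iff_of_agree {m n : ℕ} {t : Fin m → ℝ} {r : Fin m → ℕ} {t' : Fin n → ℝ}
    {r' : Fin n → ℕ} (hmn : m ≤ n) (ht : ∀ j, t' (Fin.castLE hmn j) = t j)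
    (hr : ∀ j, r' (Fin.castLE hmn j) = r j) (k : Fin m) :
    τ.choice n t' r' = some (Fin.castLE hmn k) ↔ τ.choice m t r = some k := by
  constructor
  · exact τ.nonanticipating k n m (k.2.trans_le hmn) k.2 t' r' t r fun j hj =>
      ⟨ht ⟨j, hj.trans_lt k.2⟩, hr ⟨j, hj.trans_lt k.2⟩⟩
  · exact τ.nonanticipating k m n k.2 (k.2.trans_le hmn) t r t' r' fun j hj =>
      ⟨(ht ⟨j, hj.trans_lt k.2⟩).symm, (hr ⟨j, hj.trans_lt k.2⟩).symm⟩

/-- Times and relative ranks of the first `m` arrivals are unchanged when the later items are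
deleted and the remaining ones relabelled in order. This is the form in which nonanticipation is
used. -/
theorem choice_comp {n : ℕ} {u : Fin n → ℝ} (hu : Function.Injective u) {m : ℕ}
    (e : Fin m ↪o Fin n) (hm : m ≤ n) (he : ∀ i ∉ Set.range e, ∀ j, u (e j) < u i) (k : Fin m) :
    τ.choice n (arrivalTime u) (relRank u) = some (Fin.castLE hm k) ↔
      τ.choice m (arrivalTime (u ∘ e)) (relRank (u ∘ e)) = some k :=
  τ.choice_eq_some_iff_of_agree hm (arrivalTime_comp hu e hm he) (relRank_comp hu e hm he) k

end StoppingStrategy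

/-! ### Measurability of the observations -/

section Measurability

variable {n : ℕ}

theorem measurable_itemAt (k : Fin n) : Measurable fun u : Fin n → ℝ => itemAt u k := by
  refine measurable_to_countable' fun i => ?_
  -- `Tuple.sort u` is the only permutation that sorts `u` and keeps ties in index order, which
  -- amounts to finitely many comparisons of coordinates.
  have : (fun u : Fin n → ℝ => itemAt u k) ⁻¹' {i} =
      ⋃ σ : Equiv.Perm (Fin n), ⋃ _ : σ k = i,
        (⋂ a, ⋂ b, ⋂ _ : a ≤ b, {u | u (σ a) ≤ u (σ b)}) ∩
          ⋂ a, ⋂ b, ⋂ _ : a < b, ⋂ _ : ¬ σ a < σ b, {u | u (σ a) = u (σ b)}ᶜ := by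
    ext u
    simp only [Set.mem_preimage, Set.mem_singleton_iff, Set.mem_iUnion, Set.mem_inter_iff,
      Set.mem_iInter, Set.mem_compl_iff, exists_prop, itemAt]
    constructor
    · intro h
      have h' := Tuple.eq_sort_iff.1 (rfl : Tuple.sort u = _)
      exact ⟨_, h, fun a b hab => h'.1 hab, fun a b hab hn he => hn (h'.2 a b hab he)⟩
    · rintro ⟨σ, h, h1, h2⟩
      have : σ = Tuple.sort u := Tuple.eq_sort_iff.2
        ⟨fun a b hab => h1 a b hab, fun a b hab he => by_contra fun hn => h2 a b hab hn he⟩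
      rwa [← this]
  rw [this]
  refine MeasurableSet.iUnion fun σ => MeasurableSet.iUnion fun _ => MeasurableSet.inter ?_ ?_
  · exact MeasurableSet.iInter fun a => MeasurableSet.iInter fun b => MeasurableSet.iInter fun _ =>
      measurableSet_le (measurable_pi_apply _) (measurable_pi_apply _)
  · exact MeasurableSet.iInter fun a => MeasurableSet.iInter fun b =>
      MeasurableSet.iInter fun _ => MeasurableSet.iInter fun _ =>
      (measurableSet_eq_fun (measurable_pi_apply (σ a)) (measurable_pi_apply (σ b))).compl

theorem measurable_arrivalTime (k : Fin n) : Measurable fun u : Fin n → ℝ => arrivalTime u k := by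
  have h : Measurable fun p : (Fin n → ℝ) × Fin n => p.1 p.2 :=
    measurable_from_prod_countable_left fun i => measurable_pi_apply i
  exact h.comp (measurable_id.prodMk (measurable_itemAt k))

theorem measurable_relRank (k : Fin n) : Measurable fun u : Fin n → ℝ => relRank u k := by
  have h : Measurable fun f : Fin n → Fin n =>
      (Finset.univ.filter fun j : Fin n => j ≤ k ∧ f j ≤ f k).card := .of_discrete
  exact h.comp (measurable_pi_lambda _ fun j => measurable_itemAt j)

theorem StoppingStrategy.measurableSet_choice (τ : StoppingStrategy) (k : Fin n) :
    MeasurableSet {u : Fin n → ℝ | τ.choice n (arrivalTime u) (relRank u) = some k} :=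
  (τ.measurable_choice n k).preimage
    ((measurable_pi_lambda _ fun j => measurable_arrivalTime j).prodMk
      (measurable_pi_lambda _ fun j => measurable_relRank j))

instance : IsProbabilityMeasure (volume.restrict (Set.Icc (0 : ℝ) 1)) :=
  ⟨by simp⟩

instance (n : ℕ) : IsProbabilityMeasure (arrivalLaw n) := by
  unfold arrivalLaw; infer_instance

/-- Almost surely no two items arrive at the same time. -/
theorem ae_injective_arrivalLaw (n : ℕ) : ∀ᵐ u ∂arrivalLaw n, Function.Injective u := by
  have hac : arrivalLaw n ≪ volume := by
    rw [arrivalLaw, ← Measure.restrict_pi_pi]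
    exact Measure.restrict_le_self.absolutelyContinuous
  refine hac.ae_le ?_
  have : ∀ i j : Fin n, i ≠ j → ∀ᵐ u : Fin n → ℝ, u i ≠ u j := by
    intro i j hij
    -- A tie between `i` and `j` confines `u` to a proper subspace, which is null.
    let S : Submodule ℝ (Fin n → ℝ) :=
      LinearMap.ker (LinearMap.proj (R := ℝ) (φ := fun _ : Fin n => ℝ) i - LinearMap.proj j)
    have hS : S ≠ ⊤ := by
      intro h
      have h1 : (Pi.single i 1 : Fin n → ℝ) ∈ S := h ▸ Submodule.mem_top
      simp [S, hij.symm] at h1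
    have h0 := Measure.addHaar_submodule (volume : Measure (Fin n → ℝ)) S hS
    rw [ae_iff]
    convert h0 using 2
    ext u
    simp [S, sub_eq_zero]
  have h2 : ∀ᵐ u : Fin n → ℝ, ∀ i j, i ≠ j → u i ≠ u j := by
    simp only [ae_all_iff]
    exact this
  filter_upwards [h2] with u hu i j hij
  by_contra hne
  exact hu i j hne hij

end Measurability

/-! ### The volume of the stopping events -/

/-- The arrival times of `k + 1` items for which the best item comes last and is chosen. -/
def stopRegion (τ : StoppingStrategy) (k : ℕ) : Set (Fin (k + 1) → ℝ) :=
  {w | (∀ i, i ≠ 0 → w i < w 0) ∧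
    τ.choice (k + 1) (arrivalTime w) (relRank w) = some (Fin.last k)}

/-- The volume of the configurations of `k` items after which a record at time `t` is chosen. -/
noncomputable def stopDensity (τ : StoppingStrategy) (k : ℕ) (t : ℝ) : ℝ≥0∞ :=
  arrivalLaw k {v | Fin.cons t v ∈ stopRegion τ k}

/-- The volume of the configurations of `k + 1 + m` items arriving before `s`, where the first
`k + 1` of them are given and `τ` stops at the last of these, a record. -/
noncomputable def stopIntegral (τ : StoppingStrategy) (k m : ℕ) (s : ℝ) : ℝ≥0∞ :=
  ∫⁻ t in Set.Icc 0 s, stopDensity τ k t * ENNReal.ofReal (s - t) ^ m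

/-- All arrivals are before `s`, the items in `I` come first, and `τ` stops at the last of these,
which is the best of them. -/
def initialRegion (τ : StoppingStrategy) (k : ℕ) {n : ℕ} (I : Finset (Fin n)) (s : ℝ) :
    Set (Fin n → ℝ) :=
  {u | ∃ hI : I.card = k + 1, (fun a => u (I.orderEmbOfFin hI a)) ∈ stopRegion τ k ∧
    (∀ j ∉ I, u (I.orderEmbOfFin hI 0) < u j) ∧ ∀ j, u j < s}

theorem measurableSet_stopRegion (τ : StoppingStrategy) (k : ℕ) :
    MeasurableSet (stopRegion τ k) := by
  have : stopRegion τ k = (⋂ i : Fin (k + 1), ⋂ _ : i ≠ 0, {w | w i < w 0}) ∩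
      {w | τ.choice (k + 1) (arrivalTime w) (relRank w) = some (Fin.last k)} := by
    ext w
    simp only [stopRegion, Set.mem_inter_iff, Set.mem_iInter]
    rfl
  rw [this]
  exact (MeasurableSet.iInter fun i => MeasurableSet.iInter fun _ =>
    measurableSet_lt (measurable_pi_apply i) (measurable_pi_apply 0)).inter
    (τ.measurableSet_choice _)

theorem measurable_finCons (k : ℕ) :
    Measurable fun p : ℝ × (Fin k → ℝ) => (Fin.cons p.1 p.2 : Fin (k + 1) → ℝ) := by
  refine measurable_pi_lambda _ fun i => ?_
  refine Fin.cases ?_ (fun j => ?_) i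
  · simpa using measurable_fst
  · simp only [Fin.cons_succ]
    exact (measurable_pi_apply j).comp measurable_snd

theorem measurableSet_cons_stopRegion (τ : StoppingStrategy) (k : ℕ) (t : ℝ) :
    MeasurableSet {v : Fin k → ℝ | Fin.cons t v ∈ stopRegion τ k} :=
  (measurableSet_stopRegion τ k).preimage ((measurable_finCons k).comp measurable_prodMk_left)

theorem measurable_stopDensity (τ : StoppingStrategy) (k : ℕ) : Measurable (stopDensity τ k) :=
  measurable_measure_prodMk_left
    ((measurable_finCons k) (measurableSet_stopRegion τ k))

theorem measurable_stopDensity_mul (τ : StoppingStrategy) (k m : ℕ) (s : ℝ) :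
    Measurable fun t => stopDensity τ k t * ENNReal.ofReal (s - t) ^ m :=
  (measurable_stopDensity τ k).mul (by fun_prop)

theorem measurableSet_initialRegion (τ : StoppingStrategy) (k : ℕ) {n : ℕ} (I : Finset (Fin n))
    (s : ℝ) : MeasurableSet (initialRegion τ k I s) := by
  by_cases hI : I.card = k + 1
  · have : initialRegion τ k I s =
        (fun u : Fin n → ℝ => fun a => u (I.orderEmbOfFin hI a)) ⁻¹' stopRegion τ k ∩
        ((⋂ j, ⋂ _ : j ∉ I, {u | u (I.orderEmbOfFin hI 0) < u j}) ∩ ⋂ j, {u | u j < s}) := by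
      ext u
      simp only [Set.mem_inter_iff, Set.mem_iInter]
      exact ⟨fun ⟨_, h⟩ => h, fun h => ⟨hI, h⟩⟩
    rw [this]
    refine ((measurableSet_stopRegion τ k).preimage ?_).inter (.inter ?_ ?_)
    · exact measurable_pi_lambda _ fun a => measurable_pi_apply _
    · exact .iInter fun j => .iInter fun _ =>
        measurableSet_lt (measurable_pi_apply _) (measurable_pi_apply j)
    · exact .iInter fun j => measurableSet_lt (measurable_pi_apply j) measurable_const
  · convert MeasurableSet.empty
    ext u
    simp only [Set.mem_empty_iff_false, iff_false]
    exact fun ⟨h, _⟩ => hI h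

theorem measurePreserving_arrivalLaw_split {n a b : ℕ} (e : Fin a ⊕ Fin b ≃ Fin n) :
    MeasurePreserving (fun u : Fin n → ℝ => (fun i => u (e (.inl i)), fun j => u (e (.inr j))))
      (arrivalLaw n) ((arrivalLaw a).prod (arrivalLaw b)) := by
  have h1 := (measurePreserving_piCongrLeft
    (fun _ : Fin n => volume.restrict (Set.Icc (0 : ℝ) 1)) e).symm
  have h2 := measurePreserving_sumPiEquivProdPi
    (fun _ : Fin a ⊕ Fin b => volume.restrict (Set.Icc (0 : ℝ) 1))
  exact h2.comp h1

theorem measurePreserving_arrivalLaw_succ (k : ℕ) :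
    MeasurePreserving (fun w : Fin (k + 1) → ℝ => (w 0, fun i : Fin k => w i.succ))
      (arrivalLaw (k + 1)) ((volume.restrict (Set.Icc (0 : ℝ) 1)).prod (arrivalLaw k)) :=
  measurePreserving_piFinSuccAbove
    (fun _ : Fin (k + 1) => volume.restrict (Set.Icc (0 : ℝ) 1)) 0

theorem lintegral_arrivalLaw_succ {k : ℕ} {f : ℝ → (Fin k → ℝ) → ℝ≥0∞}
    (hf : Measurable (Function.uncurry f)) :
    ∫⁻ w, f (w 0) (fun i => w i.succ) ∂arrivalLaw (k + 1) =
      ∫⁻ t in Set.Icc (0 : ℝ) 1, ∫⁻ v, f t v ∂arrivalLaw k := by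
  exact ((measurePreserving_arrivalLaw_succ k).lintegral_comp hf).trans
    (lintegral_prod _ hf.aemeasurable)

theorem arrivalLaw_pi {n : ℕ} (S : Set ℝ) :
    arrivalLaw n {u | ∀ j, u j ∈ S} = (volume.restrict (Set.Icc (0 : ℝ) 1)) S ^ n := by
  have : {u : Fin n → ℝ | ∀ j, u j ∈ S} = Set.pi Set.univ fun _ => S := by
    ext u
    simp
  rw [this, arrivalLaw, Measure.pi_pi]
  simp

theorem unitLaw_Ioo {t s : ℝ} (ht : 0 ≤ t) (hs : s ≤ 1) :
    (volume.restrict (Set.Icc (0 : ℝ) 1)) (Set.Ioo t s) = ENNReal.ofReal (s - t) := by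
  rw [Measure.restrict_apply measurableSet_Ioo, Set.inter_eq_left.2, Real.volume_Ioo]
  exact fun x hx => ⟨ht.trans hx.1.le, hx.2.le.trans hs⟩

/-- Fubini: let `t` be the arrival time of the best item of `I`. The other `k` items of `I`
contribute `stopDensity τ k t`, and each item outside `I` falls independently into `(t, s)`. Only
the order of the labels within `I` enters `stopRegion`, so all `I` of the same size give the same
value. -/
theorem arrivalLaw_initialRegion (τ : StoppingStrategy) {k n : ℕ} {I : Finset (Fin n)}
    (hI : I.card = k + 1) {s : ℝ} (hs : s ≤ 1) :
    arrivalLaw n (initialRegion τ k I s) = stopIntegral τ k (n - (k + 1)) s := by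
  have hc : Iᶜ.card = n - (k + 1) := by rw [Finset.card_compl, Fintype.card_fin, hI]
  set c := n - (k + 1)
  let e := finSumEquivOfFinset hI hc
  let A : Set ((Fin (k + 1) → ℝ) × (Fin c → ℝ)) :=
    {p | p.1 ∈ stopRegion τ k ∧ p.1 0 < s ∧ ∀ j, p.2 j ∈ Set.Ioo (p.1 0) s}
  have hA : MeasurableSet A := by
    have : A = Prod.fst ⁻¹' stopRegion τ k ∩ ({p | p.1 0 < s} ∩
        ⋂ j : Fin c, ({p : (Fin (k + 1) → ℝ) × (Fin c → ℝ) | p.1 0 < p.2 j} ∩ {p | p.2 j < s})) := by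
      ext p
      simp only [Set.mem_inter_iff, Set.mem_iInter]
      rfl
    rw [this]
    refine ((measurableSet_stopRegion τ k).preimage measurable_fst).inter (.inter ?_ ?_)
    · exact measurableSet_lt (by fun_prop) measurable_const
    · exact .iInter fun j => (measurableSet_lt (by fun_prop) (by fun_prop)).inter
        (measurableSet_lt (by fun_prop) measurable_const)
  have hpre : initialRegion τ k I s =
      (fun u : Fin n → ℝ => (fun i => u (e (.inl i)), fun j => u (e (.inr j)))) ⁻¹' A := by
    ext u
    constructor
    · rintro ⟨_, h1, h2, h3⟩
      refine ⟨h1, h3 _, fun j => ⟨h2 _ ?_, h3 _⟩⟩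
      exact Finset.mem_compl.1 (Finset.orderEmbOfFin_mem _ hc j)
    · rintro ⟨h1, h2, h3⟩
      have h4 : ∀ j ∉ I, u (I.orderEmbOfFin hI 0) < u j ∧ u j < s := by
        intro j hj
        have : j ∈ Set.range (Iᶜ.orderEmbOfFin hc) := by
          rw [Finset.range_orderEmbOfFin]
          exact Finset.mem_coe.2 (Finset.mem_compl.2 hj)
        obtain ⟨l, rfl⟩ := this
        exact h3 l
      refine ⟨hI, h1, fun j hj => (h4 j hj).1, fun j => ?_⟩
      by_cases hj : j ∈ I
      · have : j ∈ Set.range (I.orderEmbOfFin hI) := by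
          rw [Finset.range_orderEmbOfFin]
          exact Finset.mem_coe.2 hj
        obtain ⟨l, rfl⟩ := this
        by_cases hl : l = 0
        · rw [hl]
          exact h2
        · exact (h1.1 l hl).trans h2
      · exact (h4 j hj).2
  rw [hpre, (measurePreserving_arrivalLaw_split e).measure_preimage hA.nullMeasurableSet,
    Measure.prod_apply hA]
  -- The indicator is needed when `c = 0`, since the power is then `1` even for `t ≥ s`.
  let G : ℝ → ℝ≥0∞ := fun t => (Set.Iio s).indicator 1 t * ENNReal.ofReal (s - t) ^ c
  have hG : Measurable G :=
    (measurable_one.indicator measurableSet_Iio).mul (by fun_prop)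
  let F : ℝ → (Fin k → ℝ) → ℝ≥0∞ := fun t v =>
    {p : ℝ × (Fin k → ℝ) | Fin.cons p.1 p.2 ∈ stopRegion τ k}.indicator 1 (t, v) * G t
  have hF : Measurable (Function.uncurry F) :=
    (measurable_one.indicator ((measurable_finCons k) (measurableSet_stopRegion τ k))).mul
      (hG.comp measurable_fst)
  have h0 : ∀ᵐ w ∂arrivalLaw (k + 1), w 0 ∈ Set.Icc (0 : ℝ) 1 :=
    (Measure.quasiMeasurePreserving_eval
      (fun _ : Fin (k + 1) => volume.restrict (Set.Icc (0 : ℝ) 1)) 0).ae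
      (ae_restrict_mem measurableSet_Icc)
  have h1 : ∫⁻ w, arrivalLaw c (Prod.mk w ⁻¹' A) ∂arrivalLaw (k + 1) =
      ∫⁻ w, F (w 0) (fun i => w i.succ) ∂arrivalLaw (k + 1) := by
    refine lintegral_congr_ae ?_
    filter_upwards [h0] with w hw
    have hcons : (Fin.cons (w 0) fun i => w i.succ : Fin (k + 1) → ℝ) = w := Fin.cons_self_tail w
    by_cases hwQ : w ∈ stopRegion τ k
    · by_cases hws : w 0 < s
      · have : Prod.mk w ⁻¹' A = {z | ∀ j, z j ∈ Set.Ioo (w 0) s} := by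
          ext z
          exact ⟨fun h => h.2.2, fun h => ⟨hwQ, hws, h⟩⟩
        rw [this, arrivalLaw_pi, unitLaw_Ioo hw.1 hs]
        simp [F, G, hcons, hwQ, hws]
      · have : Prod.mk w ⁻¹' A = ∅ := by
          ext z
          simp only [Set.mem_empty_iff_false, iff_false]
          exact fun h => hws h.2.1
        rw [this]
        simp [F, G, hws]
    · have : Prod.mk w ⁻¹' A = ∅ := by
        ext z
        simp only [Set.mem_empty_iff_false, iff_false]
        exact fun h => hwQ h.1
      rw [this]
      simp [F, hcons, hwQ]
  rw [h1, lintegral_arrivalLaw_succ hF]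
  have h2 : ∀ t, ∫⁻ v, F t v ∂arrivalLaw k =
      (Set.Iio s).indicator (fun t => stopDensity τ k t * ENNReal.ofReal (s - t) ^ c) t := by
    intro t
    have h3 : ∀ v, {p : ℝ × (Fin k → ℝ) | Fin.cons p.1 p.2 ∈ stopRegion τ k}.indicator
        (1 : ℝ × (Fin k → ℝ) → ℝ≥0∞) (t, v) =
        {v : Fin k → ℝ | Fin.cons t v ∈ stopRegion τ k}.indicator 1 v := fun v => rfl
    have hm := measurableSet_cons_stopRegion τ k t
    simp only [F, h3]
    rw [lintegral_mul_const _ (measurable_one.indicator hm), lintegral_indicator_one hm]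
    by_cases hts : t < s <;> simp [G, hts, stopDensity]
  simp only [h2]
  rw [lintegral_indicator measurableSet_Iio, Measure.restrict_restrict measurableSet_Iio,
    stopIntegral]
  refine setLIntegral_congr ?_
  have : Set.Iio s ∩ Set.Icc 0 1 = Set.Ico 0 s := by
    ext t
    simp only [Set.mem_inter_iff, Set.mem_Iio, Set.mem_Icc, Set.mem_Ico]
    exact ⟨fun h => ⟨h.2.1, h.1⟩, fun h => ⟨h.2, h.1, h.2.le.trans hs⟩⟩
  rw [this]
  exact Ico_ae_eq_Icc

theorem ae_lt_one_arrivalLaw (n : ℕ) : ∀ᵐ u ∂arrivalLaw n, ∀ j, u j < 1 := by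
  rw [ae_all_iff]
  intro j
  refine (Measure.quasiMeasurePreserving_eval
      (fun _ : Fin n => volume.restrict (Set.Icc (0 : ℝ) 1)) j).ae
      (p := fun x : ℝ => x < 1) ?_
  rw [← restrict_Ico_eq_restrict_Icc]
  filter_upwards [ae_restrict_mem measurableSet_Ico] with x hx using hx.2

/-! ### Decomposition of stopping and winning according to the set of items seen -/

/-- `τ` stops before time `s` if exactly `n` items arrive before `s`. -/
def stoppedRegion (τ : StoppingStrategy) (n : ℕ) (s : ℝ) : Set (Fin n → ℝ) :=
  {u | (∀ j, u j < s) ∧ ∃ k, τ.choice n (arrivalTime u) (relRank u) = some k}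

theorem choice_of_mem_initialRegion {τ : StoppingStrategy} {k n : ℕ} {I : Finset (Fin n)} {s : ℝ}
    {u : Fin n → ℝ} (hu : Function.Injective u) (h : u ∈ initialRegion τ k I s) (hk : k < n) :
    τ.choice n (arrivalTime u) (relRank u) = some ⟨k, hk⟩ := by
  obtain ⟨hI, h1, h2, -⟩ := h
  refine (τ.choice_comp hu (I.orderEmbOfFin hI) hk ?_ (Fin.last k)).2 h1.2
  intro i hi j
  rw [Finset.range_orderEmbOfFin, Finset.mem_coe] at hi
  refine lt_of_le_of_lt ?_ (h2 i hi)
  by_cases hj : j = 0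
  · rw [hj]
  · exact (h1.1 j hj).le

theorem initialRegion_le_iff {τ : StoppingStrategy} {k n : ℕ} {I : Finset (Fin n)} {s : ℝ}
    {u : Fin n → ℝ} (h : u ∈ initialRegion τ k I s) : ∃ t, ∀ j, j ∈ I ↔ u j ≤ t := by
  obtain ⟨hI, h1, h2, -⟩ := h
  refine ⟨u (I.orderEmbOfFin hI 0), fun j => ⟨fun hj => ?_, fun hj => ?_⟩⟩
  · have : j ∈ Set.range (I.orderEmbOfFin hI) := by
      rw [Finset.range_orderEmbOfFin]
      exact Finset.mem_coe.2 hj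
    obtain ⟨l, rfl⟩ := this
    by_cases hl : l = 0
    · rw [hl]
    · exact (h1.1 l hl).le
  · by_contra hn
    exact (h2 j hn).not_ge hj

/-- Both sets would be sublevel sets of `u`. These are nested, so two of the same size coincide. -/
theorem disjoint_initialRegion {τ : StoppingStrategy} {k n : ℕ} {I J : Finset (Fin n)} {s : ℝ}
    (hIJ : I ≠ J) : Disjoint (initialRegion τ k I s) (initialRegion τ k J s) := by
  rw [Set.disjoint_left]
  intro u hu hv
  obtain ⟨t, ht⟩ := initialRegion_le_iff hu
  obtain ⟨t', ht'⟩ := initialRegion_le_iff hv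
  have hcard : I.card = J.card := hu.1.trans hv.1.symm
  rcases le_total t t' with h | h
  · exact hIJ (Finset.eq_of_subset_of_card_le
      (fun j hj => (ht' j).2 (((ht j).1 hj).trans h)) hcard.ge)
  · exact hIJ (Finset.eq_of_subset_of_card_le
      (fun j hj => (ht j).2 (((ht' j).1 hj).trans h)) hcard.le).symm

/-- The binomial coefficient counts the sets `I` of the first `k + 1` items. Distinct `k` give
almost surely disjoint events because `k` is the chosen position. -/
theorem sum_stopIntegral_le_stoppedRegion (τ : StoppingStrategy) (n : ℕ) {s : ℝ} (hs : s ≤ 1) :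
    ∑ k ∈ Finset.range (n + 1), ((n + 1).choose (k + 1) : ℝ≥0∞) * stopIntegral τ k (n - k) s ≤
      arrivalLaw (n + 1) (stoppedRegion τ (n + 1) s) := by
  let inj : Set (Fin (n + 1) → ℝ) := {u | Function.Injective u}
  let E : ℕ → Set (Fin (n + 1) → ℝ) := fun k =>
    ⋃ I ∈ Finset.powersetCard (k + 1) Finset.univ, initialRegion τ k I s
  have hE : ∀ k, MeasurableSet (E k) := fun k =>
    Finset.measurableSet_biUnion _ fun I _ => measurableSet_initialRegion τ k I s
  have hEv : ∀ k, arrivalLaw (n + 1) (E k) =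
      ((n + 1).choose (k + 1) : ℝ≥0∞) * stopIntegral τ k (n - k) s := by
    intro k
    rw [measure_biUnion_finset (fun I _ J _ hIJ => disjoint_initialRegion hIJ)
      fun I _ => measurableSet_initialRegion τ k I s]
    rw [Finset.sum_congr rfl fun I hI =>
      arrivalLaw_initialRegion τ (Finset.mem_powersetCard.1 hI).2 hs]
    simp
  have hEc : ∀ k ∈ Finset.range (n + 1), ∀ u ∈ E k, u ∈ inj → (∀ j, u j < s) ∧
      ∃ p : Fin (n + 1), (p : ℕ) = k ∧ τ.choice (n + 1) (arrivalTime u) (relRank u) = some p := by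
    intro k hk u hu hinj
    simp only [E, Set.mem_iUnion] at hu
    obtain ⟨I, -, hu⟩ := hu
    obtain ⟨-, -, -, h3⟩ := id hu
    exact ⟨h3, _, rfl, choice_of_mem_initialRegion hinj hu (Finset.mem_range.1 hk)⟩
  simp only [← hEv]
  rw [← measure_biUnion_finset₀ _ fun k _ => (hE k).nullMeasurableSet]
  · refine measure_mono_ae ?_
    filter_upwards [ae_injective_arrivalLaw (n + 1)] with u hinj hu
    obtain ⟨k, hk, hu⟩ := Set.mem_iUnion₂.1 hu
    obtain ⟨h1, p, -, h2⟩ := hEc k hk u hu hinj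
    exact ⟨h1, p, h2⟩
  · intro k hk l hl hkl
    have h0 : arrivalLaw (n + 1) {u | ¬ Function.Injective u} = 0 :=
      ae_iff.1 (ae_injective_arrivalLaw (n + 1))
    refine measure_mono_null (fun u hu => ?_) h0
    intro hinj
    obtain ⟨-, p, hp, h1⟩ := hEc k hk u hu.1 hinj
    obtain ⟨-, p', hp', h2⟩ := hEc l hl u hu.2 hinj
    rw [h1, Option.some_inj] at h2
    exact hkl (hp ▸ hp' ▸ congrArg Fin.val h2)

/-- Winning with the choice in position `k` means that the best item is in position `k`. -/
theorem itemAt_eq_zero_of_win {m : ℕ} {u : Fin (m + 1) → ℝ} {k : Fin (m + 1)}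
    (hk : relRank u k = 1) (hl : ∀ j, k < j → 1 < relRank u j) : itemAt u k = 0 := by
  obtain ⟨p, hp⟩ := exists_itemAt_eq u 0
  rcases lt_trichotomy p k with h | rfl | h
  · have := (relRank_eq_one_iff u k).1 hk p h
    rw [hp] at this
    exact absurd this (Fin.not_lt_zero _)
  · exact hp
  · refine absurd ((relRank_eq_one_iff u p).2 fun j hj => ?_) (hl p h).ne'
    rw [hp, Fin.pos_iff_ne_zero]
    intro h0
    exact hj.ne ((Tuple.sort u).injective (h0.trans hp.symm))

/-- On a win the set of items seen at the stop contains the overall best item `0`, so only the other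
`k` items are free. This gives `n.choose k` in `winProbAt_le_sum_stopIntegral`, against `(n +
1).choose (k + 1)` for stopping. -/
theorem mem_initialRegion_of_win {τ : StoppingStrategy} {m : ℕ} {u : Fin (m + 1) → ℝ} {s : ℝ}
    (hu : Function.Injective u) (hs : ∀ j, u j < s) (h : u ∈ winEvent τ (m + 1)) :
    ∃ k < m + 1, ∃ J ∈ Finset.powersetCard k (Finset.univ.erase (0 : Fin (m + 1))),
      u ∈ initialRegion τ k (insert 0 J) s := by
  obtain ⟨k, hc, hr, hl⟩ := h
  have h0 := itemAt_eq_zero_of_win hr hl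
  set I : Finset (Fin (m + 1)) := Finset.univ.filter fun i => u i ≤ u 0
  have h0I : 0 ∈ I := by simp [I]
  have hI : I.card = k + 1 := by
    have : I = insert 0 (Finset.univ.filter fun i => u i < u (itemAt u k)) := by
      ext i
      simp only [I, h0, Finset.mem_filter, Finset.mem_univ, true_and, Finset.mem_insert]
      rw [le_iff_lt_or_eq, hu.eq_iff, or_comm]
    rw [this, Finset.card_insert_of_notMem, card_lt_itemAt hu]
    simp [h0]
  refine ⟨k, k.2, I.erase 0, ?_, ?_⟩
  · rw [Finset.mem_powersetCard, Finset.card_erase_of_mem h0I, hI]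
    exact ⟨Finset.erase_subset_erase _ (Finset.subset_univ _), rfl⟩
  · rw [Finset.insert_erase h0I]
    have he0 : I.orderEmbOfFin hI 0 = 0 := by
      have : (0 : Fin (m + 1)) ∈ Set.range (I.orderEmbOfFin hI) := by
        rw [Finset.range_orderEmbOfFin]
        exact Finset.mem_coe.2 h0I
      obtain ⟨l, hl⟩ := this
      refine le_antisymm ?_ (Fin.zero_le _)
      rw [← hl, OrderEmbedding.le_iff_le]
      exact Fin.zero_le l
    have hout : ∀ i ∉ I, u 0 < u i := fun i hi => by simpa [I] using hi
    have hin : ∀ a, u (I.orderEmbOfFin hI a) ≤ u 0 := fun a =>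
      (Finset.mem_filter.1 (Finset.orderEmbOfFin_mem I hI a)).2
    refine ⟨hI, ⟨fun i hi => ?_, ?_⟩, ?_, hs⟩
    · simp only [he0]
      refine lt_of_le_of_ne (hin i) fun h => hi ?_
      exact (I.orderEmbOfFin hI).injective ((hu h).trans he0.symm)
    · refine (τ.choice_comp hu (I.orderEmbOfFin hI) k.2 ?_ (Fin.last k)).1 hc
      intro i hi j
      rw [Finset.range_orderEmbOfFin, Finset.mem_coe] at hi
      exact (hin j).trans_lt (hout i hi)
    · rw [he0]
      exact hout

theorem winProbAt_le_sum_stopIntegral (τ : StoppingStrategy) (n : ℕ) :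
    winProbAt τ (n + 1) ≤
      ∑ k ∈ Finset.range (n + 1), (n.choose k : ℝ≥0∞) * stopIntegral τ k (n - k) 1 := by
  calc winProbAt τ (n + 1)
      ≤ arrivalLaw (n + 1) (⋃ k ∈ Finset.range (n + 1),
          ⋃ J ∈ Finset.powersetCard k (Finset.univ.erase (0 : Fin (n + 1))),
            initialRegion τ k (insert 0 J) 1) := by
        refine measure_mono_ae ?_
        filter_upwards [ae_injective_arrivalLaw (n + 1), ae_lt_one_arrivalLaw (n + 1)]
          with u hinj hlt hu
        obtain ⟨k, hk, J, hJ, h⟩ := mem_initialRegion_of_win hinj hlt hu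
        exact Set.mem_biUnion (Finset.mem_range.2 hk) (Set.mem_biUnion hJ h)
    _ ≤ ∑ k ∈ Finset.range (n + 1),
          ∑ J ∈ Finset.powersetCard k (Finset.univ.erase (0 : Fin (n + 1))),
            arrivalLaw (n + 1) (initialRegion τ k (insert 0 J) 1) :=
        (measure_biUnion_finset_le _ _).trans
          (Finset.sum_le_sum fun k _ => measure_biUnion_finset_le _ _)
    _ = _ := by
        refine Finset.sum_congr rfl fun k _ => ?_
        rw [Finset.sum_congr rfl fun J hJ => ?_]
        rotate_left
        · exact fun _ => stopIntegral τ k (n - k) 1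
        · obtain ⟨h1, h2⟩ := Finset.mem_powersetCard.1 hJ
          have h3 : (0 : Fin (n + 1)) ∉ J := fun h => by simpa using h1 h
          rw [arrivalLaw_initialRegion τ (k := k) (by rw [Finset.card_insert_of_notMem h3, h2])
            le_rfl]
          congr 1
          omega
        · simp

/-- Having stopped before `s` and stopping at `s` are disjoint events. -/
theorem stopDensity_add_stoppedRegion_le (τ : StoppingStrategy) (n : ℕ) {s : ℝ} (hs : s ≤ 1) :
    stopDensity τ n s + arrivalLaw n (stoppedRegion τ n s) ≤ ENNReal.ofReal s ^ n := by
  have hm := measurableSet_cons_stopRegion τ n s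
  rw [stopDensity, ← measure_union₀' hm.nullMeasurableSet]
  · have : (volume.restrict (Set.Icc (0 : ℝ) 1)) (Set.Iio s) = ENNReal.ofReal s := by
      rw [Measure.restrict_apply measurableSet_Iio]
      have : Set.Iio s ∩ Set.Icc 0 1 = Set.Ico 0 s := by
        ext t
        simp only [Set.mem_inter_iff, Set.mem_Iio, Set.mem_Icc, Set.mem_Ico]
        exact ⟨fun h => ⟨h.2.1, h.1⟩, fun h => ⟨h.2, h.1, h.2.le.trans hs⟩⟩
      rw [this, Real.volume_Ico, sub_zero]
    rw [← this, ← arrivalLaw_pi]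
    refine measure_mono (Set.union_subset (fun v hv j => ?_) fun v hv => hv.1)
    simpa using hv.1 j.succ (Fin.succ_ne_zero j)
  · have hn : arrivalLaw n {u | ¬ Function.Injective u} = 0 :=
      ae_iff.1 (ae_injective_arrivalLaw n)
    refine measure_mono_null (fun v hv => ?_) hn
    intro hinj
    obtain ⟨⟨h1, h2⟩, h3, k, h4⟩ := hv
    have hw : Function.Injective (Fin.cons s v : Fin (n + 1) → ℝ) := by
      rw [Fin.cons_injective_iff]
      refine ⟨?_, hinj⟩
      rintro ⟨j, hj⟩
      exact (h3 j).ne hj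
    -- Inserting a new best item at time `s` comes after all of `v`, so a stop already made at `k`
    -- persists and contradicts the choice of the last position.
    have h5 := (τ.choice_comp hw (Fin.succOrderEmb n) n.le_succ ?_ k).2 h4
    · rw [h2, Option.some_inj] at h5
      exact absurd (congrArg Fin.val h5) k.2.ne'
    · intro i hi j
      have : i = 0 := by
        by_contra hne
        exact hi ⟨i.pred hne, by simp⟩
      subst this
      simpa using h3 j

/-! ### The geometric distribution -/

/-- The probability that exactly `l` items arrive before time `s` if their total number has the
geometric distribution with parameter `q` on the nonnegative integers. -/
noncomputable def geomCount (q : ℝ) (l : ℕ) (s : ℝ) : ℝ :=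
  (1 - q) * q ^ l / (1 - q + q * s) ^ (l + 1)

section Geometric

variable {q : ℝ}

theorem geomScale_pos (h0 : 0 < q) (h1 : q < 1) {s : ℝ} (hs : 0 ≤ s) : 0 < 1 - q + q * s := by
  have := mul_nonneg h0.le hs
  linarith

theorem geomCount_nonneg (h0 : 0 < q) (h1 : q < 1) (l : ℕ) {s : ℝ} (hs : 0 ≤ s) :
    0 ≤ geomCount q l s :=
  div_nonneg (mul_nonneg (by linarith) (pow_nonneg h0.le _))
    (pow_nonneg (geomScale_pos h0 h1 hs).le _)

/-- The ratio does not depend on `l`: this is what makes the record intensity independent of the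
past and singles out the geometric law. -/
theorem geomCount_succ (h0 : 0 < q) (h1 : q < 1) (l : ℕ) {s : ℝ} (hs : 0 ≤ s) :
    geomCount q (l + 1) s = q / (1 - q + q * s) * geomCount q l s := by
  have := (geomScale_pos h0 h1 hs).ne'
  unfold geomCount
  field_simp
  ring

/-- Consistency in time: summing over the number `m` of arrivals between `t` and `s` recovers the
weights at `t`. It is the negative binomial series with ratio `q (s - t) / (1 - q + q s)`. -/
theorem hasSum_geomCount_choose (h0 : 0 < q) (h1 : q < 1) (k : ℕ) {t s : ℝ} (ht : 0 ≤ t)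
    (hts : t ≤ s) :
    HasSum (fun m => geomCount q (k + m) s * ((k + m).choose k * (s - t) ^ m))
      (geomCount q k t) := by
  have hz := geomScale_pos h0 h1 (ht.trans hts)
  have hz' := geomScale_pos h0 h1 ht
  set z := 1 - q + q * s with hzdef
  have hr : ‖q * (s - t) / z‖ < 1 := by
    rw [Real.norm_of_nonneg (div_nonneg (mul_nonneg h0.le (sub_nonneg.2 hts)) hz.le),
      div_lt_one hz]
    linarith
  have h := (hasSum_choose_mul_geometric_of_norm_lt_one k hr).mul_left (geomCount q k s)
  have he : 1 - q * (s - t) / z = (1 - q + q * t) / z := by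
    field_simp
    rw [hzdef]
    ring
  rw [he] at h
  have h3 : geomCount q k s * (1 / ((1 - q + q * t) / z) ^ (k + 1)) = geomCount q k t := by
    unfold geomCount
    rw [← hzdef, div_pow]
    field_simp
  rw [h3] at h
  refine h.congr_fun fun m => ?_
  unfold geomCount
  rw [← hzdef, add_comm m k, div_pow, mul_pow]
  field_simp
  ring

theorem tsum_geomCount_choose (h0 : 0 < q) (h1 : q < 1) (k : ℕ) {t s : ℝ} (ht : 0 ≤ t)
    (hts : t ≤ s) :
    ∑' m, ENNReal.ofReal (geomCount q (k + m) s) *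
      (((k + m).choose k : ℝ≥0∞) * ENNReal.ofReal (s - t) ^ m) =
      ENNReal.ofReal (geomCount q k t) := by
  have h := hasSum_geomCount_choose h0 h1 k ht hts
  have hst := sub_nonneg.2 hts
  have hn : ∀ m, 0 ≤ geomCount q (k + m) s * ((k + m).choose k * (s - t) ^ m) := fun m =>
    mul_nonneg (geomCount_nonneg h0 h1 _ (ht.trans hts))
      (mul_nonneg (Nat.cast_nonneg _) (pow_nonneg hst _))
  rw [← h.tsum_eq, ENNReal.ofReal_tsum_of_nonneg hn h.summable]
  refine tsum_congr fun m => ?_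
  rw [ENNReal.ofReal_mul (geomCount_nonneg h0 h1 _ (ht.trans hts)),
    ENNReal.ofReal_mul (Nat.cast_nonneg _), ENNReal.ofReal_pow hst, ENNReal.ofReal_natCast]

/-- The formula for `geomCount` omits the factor `s ^ l`, the probability that `l` given items come
before `s`; with it the weights sum to `1`. -/
theorem tsum_geomCount_mul_pow (h0 : 0 < q) (h1 : q < 1) {s : ℝ} (hs : 0 ≤ s) :
    ∑' l, ENNReal.ofReal (geomCount q l s) * ENNReal.ofReal s ^ l = 1 := by
  have h := tsum_geomCount_choose h0 h1 0 le_rfl hs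
  have h2 : geomCount q 0 0 = 1 := by
    have : 1 - q ≠ 0 := by linarith
    simp [geomCount, this]
  simpa [h2] using h

/-- The density, relative to the intensity of the records, of the time at which `τ` stops. -/
noncomputable def stopRate (τ : StoppingStrategy) (q t : ℝ) : ℝ≥0∞ :=
  ∑' k, ENNReal.ofReal (geomCount q k t) * stopDensity τ k t

theorem measurable_geomCount (k : ℕ) : Measurable (geomCount q k) := by
  unfold geomCount
  fun_prop

theorem measurable_stopRate (τ : StoppingStrategy) : Measurable (stopRate τ q) :=
  Measurable.tsum fun k =>
    (measurable_geomCount k).ennreal_ofReal.mul (measurable_stopDensity τ k)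

theorem tsum_tsum_eq_tsum_sum_range (f : ℕ → ℕ → ℝ≥0∞) :
    ∑' k, ∑' m, f k m = ∑' n, ∑ k ∈ Finset.range (n + 1), f k (n - k) := by
  rw [← ENNReal.tsum_prod, ← Finset.HasAntidiagonal.sigmaAntidiagonalEquivProd.tsum_eq, ENNReal.tsum_sigma']
  refine tsum_congr fun n => ?_
  rw [tsum_fintype, Finset.univ_eq_attach, ← Finset.Nat.sum_antidiagonal_eq_sum_range_succ f]
  exact Finset.sum_attach (Finset.HasAntidiagonal.antidiagonal n) fun p => f p.1 p.2

/-- The shift `i` says whether the chosen item is counted: `i = 1` for having stopped before `s`, `i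
= 0` for a win, where the overall best item is left out of the count. -/
theorem tsum_stopIntegral (h0 : 0 < q) (h1 : q < 1) (τ : StoppingStrategy) (i k : ℕ) {s : ℝ} :
    ∑' m, ENNReal.ofReal (geomCount q (k + i + m) s) *
      (((k + i + m).choose (k + i) : ℝ≥0∞) * stopIntegral τ k m s) =
      ∫⁻ t in Set.Icc 0 s, ENNReal.ofReal (geomCount q (k + i) t) * stopDensity τ k t := by
  have hm : ∀ m, Measurable fun t => ENNReal.ofReal (geomCount q (k + i + m) s) *
      (((k + i + m).choose (k + i) : ℝ≥0∞) *
        (stopDensity τ k t * ENNReal.ofReal (s - t) ^ m)) := fun m =>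
    ((measurable_stopDensity_mul τ k m s).const_mul _).const_mul _
  simp only [stopIntegral]
  calc _ = ∑' m, ∫⁻ t in Set.Icc 0 s, ENNReal.ofReal (geomCount q (k + i + m) s) *
      (((k + i + m).choose (k + i) : ℝ≥0∞) *
        (stopDensity τ k t * ENNReal.ofReal (s - t) ^ m)) := by
        refine tsum_congr fun m => ?_
        rw [lintegral_const_mul _ ((measurable_stopDensity_mul τ k m s).const_mul _),
          lintegral_const_mul _ (measurable_stopDensity_mul τ k m s)]
    _ = ∫⁻ t in Set.Icc 0 s, ∑' m, ENNReal.ofReal (geomCount q (k + i + m) s) *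
      (((k + i + m).choose (k + i) : ℝ≥0∞) *
        (stopDensity τ k t * ENNReal.ofReal (s - t) ^ m)) :=
        (lintegral_tsum fun m => (hm m).aemeasurable).symm
    _ = _ := by
        refine setLIntegral_congr_fun measurableSet_Icc fun t ht => ?_
        rw [← tsum_geomCount_choose h0 h1 (k + i) ht.1 ht.2, ← ENNReal.tsum_mul_right]
        exact tsum_congr fun m => by ring

/-- Having stopped before `s` and stopping at a record at `s` have total probability at most `1`;
the latter is measured relative to the intensity of the records. -/
theorem stopRate_add_lintegral_le (h0 : 0 < q) (h1 : q < 1) (τ : StoppingStrategy) {s : ℝ}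
    (hs : s ∈ Set.Icc (0 : ℝ) 1) :
    stopRate τ q s + ∫⁻ t in Set.Icc 0 s, ENNReal.ofReal (q / (1 - q + q * t)) * stopRate τ q t
      ≤ 1 := by
  have hA : ∫⁻ t in Set.Icc 0 s, ENNReal.ofReal (q / (1 - q + q * t)) * stopRate τ q t ≤
      ∑' n, ENNReal.ofReal (geomCount q n s) * arrivalLaw n (stoppedRegion τ n s) := by
    calc _ = ∫⁻ t in Set.Icc 0 s, ∑' k,
            ENNReal.ofReal (geomCount q (k + 1) t) * stopDensity τ k t := by
          refine setLIntegral_congr_fun measurableSet_Icc fun t ht => ?_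
          simp only [stopRate]
          rw [← ENNReal.tsum_mul_left]
          refine tsum_congr fun k => ?_
          -- The record intensity is absorbed by counting the chosen item as well.
          rw [geomCount_succ h0 h1 k ht.1,
            ENNReal.ofReal_mul (div_nonneg h0.le (geomScale_pos h0 h1 ht.1).le), mul_assoc]
      _ = ∑' k, ∫⁻ t in Set.Icc 0 s,
            ENNReal.ofReal (geomCount q (k + 1) t) * stopDensity τ k t :=
          lintegral_tsum fun k => ((measurable_geomCount _).ennreal_ofReal.mul
            (measurable_stopDensity τ k)).aemeasurable
      _ = ∑' k, ∑' m, ENNReal.ofReal (geomCount q (k + 1 + m) s) *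
            (((k + 1 + m).choose (k + 1) : ℝ≥0∞) * stopIntegral τ k m s) :=
          tsum_congr fun k => (tsum_stopIntegral h0 h1 τ 1 k).symm
      _ = ∑' n, ENNReal.ofReal (geomCount q (n + 1) s) * ∑ k ∈ Finset.range (n + 1),
            (((n + 1).choose (k + 1) : ℝ≥0∞) * stopIntegral τ k (n - k) s) := by
          rw [tsum_tsum_eq_tsum_sum_range]
          refine tsum_congr fun n => ?_
          rw [Finset.mul_sum]
          refine Finset.sum_congr rfl fun k hk => ?_
          have : k + 1 + (n - k) = n + 1 := by
            have := Finset.mem_range.1 hk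
            omega
          rw [this]
      _ ≤ ∑' n, ENNReal.ofReal (geomCount q (n + 1) s) *
            arrivalLaw (n + 1) (stoppedRegion τ (n + 1) s) :=
          ENNReal.tsum_le_tsum fun n =>
            mul_le_mul_right (sum_stopIntegral_le_stoppedRegion τ n hs.2) _
      _ ≤ _ := by
          -- The sum on the left starts at one item; the term for no items is added for free.
          rw [tsum_eq_zero_add' (f := fun n => ENNReal.ofReal (geomCount q n s) *
            arrivalLaw n (stoppedRegion τ n s)) ENNReal.summable]
          exact le_add_self
  calc _ ≤ _ := add_le_add_right hA _
    _ = ∑' n, ENNReal.ofReal (geomCount q n s) *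
          (stopDensity τ n s + arrivalLaw n (stoppedRegion τ n s)) := by
        rw [stopRate, ← ENNReal.tsum_add]
        exact tsum_congr fun n => (mul_add _ _ _).symm
    _ ≤ ∑' n, ENNReal.ofReal (geomCount q n s) * ENNReal.ofReal s ^ n :=
        ENNReal.tsum_le_tsum fun n =>
          mul_le_mul_right (stopDensity_add_stoppedRegion_le τ n hs.2) _
    _ = 1 := tsum_geomCount_mul_pow h0 h1 hs.1

/-- The geometric distribution with parameter `q` on the positive integers. -/
noncomputable def geomPMF (h0 : 0 < q) (h1 : q < 1) : PMF ℕ+ :=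
  ⟨fun n => ENNReal.ofReal ((1 - q) * q ^ n.natPred), by
    have h := (hasSum_geometric_of_lt_one h0.le h1).mul_left (1 - q)
    rw [mul_inv_cancel₀ (by linarith)] at h
    have h2 : ∑' n : ℕ+, ENNReal.ofReal ((1 - q) * q ^ n.natPred) = 1 := by
      refine (Equiv.pnatEquivNat.tsum_eq fun n : ℕ => ENNReal.ofReal ((1 - q) * q ^ n)).trans ?_
      rw [← ENNReal.ofReal_tsum_of_nonneg (fun n => mul_nonneg (by linarith) (pow_nonneg h0.le _))
          h.summable, h.tsum_eq, ENNReal.ofReal_one]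
    rw [← h2]
    exact ENNReal.summable.hasSum⟩

theorem geomPMF_apply (h0 : 0 < q) (h1 : q < 1) (n : ℕ+) :
    geomPMF h0 h1 n = ENNReal.ofReal ((1 - q) * q ^ n.natPred) := rfl

/-- Under `geomPMF` the number of items other than the best is geometric on the nonnegative
integers. Hence the weights are `geomCount q n 1` for `n + 1` items, and the integrand carries no
record intensity. -/
theorem winProb_geomPMF_le (h0 : 0 < q) (h1 : q < 1) (τ : StoppingStrategy) :
    winProb τ (geomPMF h0 h1) ≤ ∫⁻ t in Set.Icc 0 1, stopRate τ q t := by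
  calc winProb τ (geomPMF h0 h1)
      = ∑' n : ℕ, ENNReal.ofReal (geomCount q n 1) * winProbAt τ (n + 1) := by
        rw [winProb, ← Equiv.pnatEquivNat.symm.tsum_eq]
        refine tsum_congr fun n => ?_
        simp [geomPMF_apply, geomCount, Equiv.pnatEquivNat]
    _ ≤ ∑' n : ℕ, ENNReal.ofReal (geomCount q n 1) *
          ∑ k ∈ Finset.range (n + 1), (n.choose k : ℝ≥0∞) * stopIntegral τ k (n - k) 1 :=
        ENNReal.tsum_le_tsum fun n => mul_le_mul_right (winProbAt_le_sum_stopIntegral τ n) _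
    _ = ∑' k, ∑' m, ENNReal.ofReal (geomCount q (k + 0 + m) 1) *
          (((k + 0 + m).choose (k + 0) : ℝ≥0∞) * stopIntegral τ k m 1) := by
        rw [tsum_tsum_eq_tsum_sum_range]
        refine tsum_congr fun n => ?_
        rw [Finset.mul_sum]
        refine Finset.sum_congr rfl fun k hk => ?_
        have : k + 0 + (n - k) = n := by
          have := Finset.mem_range.1 hk
          omega
        rw [this, add_zero]
    _ = ∑' k, ∫⁻ t in Set.Icc 0 1, ENNReal.ofReal (geomCount q k t) * stopDensity τ k t :=
        tsum_congr fun k => tsum_stopIntegral h0 h1 τ 0 k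
    _ = _ := (lintegral_tsum fun k => ((measurable_geomCount _).ennreal_ofReal.mul
            (measurable_stopDensity τ k)).aemeasurable).symm

end Geometric

/-! ### The bound for the stopping problem with Poisson records -/

section Duality

variable {q : ℝ}

/-- The dual weight: the gain from stopping at a record over continuing optimally, times the
intensity of the records. -/
noncomputable def dualWeight (q t : ℝ) : ℝ := q * (1 + Real.log (1 - q + q * t))

theorem measurable_dualWeight : Measurable (dualWeight q) := by
  unfold dualWeight
  fun_prop

/-- With `z = 1 - q + q t`, the weight is the derivative of `z log z`, which vanishes at `t = 1`.
The bound `hz` makes the weight nonnegative on `[a, 1]`, so that `ENNReal.ofReal` truncates nothing.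
-/
theorem lintegral_dualWeight (h0 : 0 < q) (h1 : q < 1) {a : ℝ} (ha : 0 ≤ a) (ha1 : a ≤ 1)
    (hz : 1 / Real.exp 1 ≤ 1 - q + q * a) :
    ∫⁻ t in Set.Icc a 1, ENNReal.ofReal (dualWeight q t) =
      ENNReal.ofReal (-((1 - q + q * a) * Real.log (1 - q + q * a))) := by
  have hpos : ∀ t ∈ Set.Icc a 1, 0 < 1 - q + q * t := fun t ht =>
    geomScale_pos h0 h1 (ha.trans ht.1)
  have hnn : ∀ t ∈ Set.Icc a 1, 0 ≤ dualWeight q t := by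
    intro t ht
    refine mul_nonneg h0.le ?_
    have h2 : 1 / Real.exp 1 ≤ 1 - q + q * t :=
      hz.trans (by have := mul_le_mul_of_nonneg_left ht.1 h0.le; linarith)
    have h3 := Real.log_le_log (by positivity) h2
    rw [one_div, Real.log_inv, Real.log_exp] at h3
    linarith
  have hd : ∀ t ∈ Set.uIcc a 1,
      HasDerivAt (fun t => (1 - q + q * t) * Real.log (1 - q + q * t)) (dualWeight q t) t := by
    intro t ht
    rw [Set.uIcc_of_le ha1] at ht
    have hlin : HasDerivAt (fun t => 1 - q + q * t) q t := by
      simpa using ((hasDerivAt_id t).const_mul q).const_add (1 - q)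
    have hne := (hpos t ht).ne'
    refine (hlin.mul (hlin.log hne)).congr_deriv ?_
    unfold dualWeight
    field_simp
    ring
  have hc : ContinuousOn (dualWeight q) (Set.Icc a 1) := by
    unfold dualWeight
    refine continuousOn_const.mul (continuousOn_const.add (ContinuousOn.log (by fun_prop) ?_))
    exact fun t ht => (hpos t ht).ne'
  have hi : IntervalIntegrable (dualWeight q) volume a 1 := by
    refine ContinuousOn.intervalIntegrable ?_
    rwa [Set.uIcc_of_le ha1]
  have hint := intervalIntegral.integral_eq_sub_of_hasDerivAt hd hi
  rw [← ofReal_integral_eq_lintegral_ofReal (hc.integrableOn_Icc)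
    ((ae_restrict_iff' measurableSet_Icc).2 (Filter.Eventually.of_forall hnn)),
    integral_Icc_eq_integral_Ioc, ← intervalIntegral.integral_of_le ha1, hint]
  congr 1
  have : (1 - q + q * 1) = 1 := by ring
  rw [this, Real.log_one]
  ring

theorem one_div_exp_mul_log : -(1 / Real.exp 1 * Real.log (1 / Real.exp 1)) = 1 / Real.exp 1 := by
  rw [one_div, Real.log_inv, Real.log_exp]
  ring

/-- The dual weights vanish up to the time at which the scale `1 - q + q * a` reaches `1 / e`. -/
theorem lintegral_dualWeight_threshold (h0 : 0 < q) (h1 : q < 1) (hq : 1 - q ≤ 1 / Real.exp 1) :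
    ∃ a ∈ Set.Icc (0 : ℝ) 1, 1 - q + q * a = 1 / Real.exp 1 ∧
      ∫⁻ t in Set.Icc a 1, ENNReal.ofReal (dualWeight q t) = ENNReal.ofReal (1 / Real.exp 1) := by
  have he : 1 / Real.exp 1 ≤ 1 := by
    rw [div_le_one (Real.exp_pos 1)]
    exact Real.one_le_exp zero_le_one
  have h2 : 1 - q + q * ((1 / Real.exp 1 - (1 - q)) / q) = 1 / Real.exp 1 := by
    field_simp
    ring
  have ha : 0 ≤ (1 / Real.exp 1 - (1 - q)) / q := div_nonneg (by linarith) h0.le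
  have ha1 : (1 / Real.exp 1 - (1 - q)) / q ≤ 1 := by
    rw [div_le_one h0]
    linarith
  refine ⟨_, ⟨ha, ha1⟩, h2, ?_⟩
  rw [lintegral_dualWeight h0 h1 ha ha1 h2.ge, h2, one_div_exp_mul_log]

theorem lintegral_dualWeight_zero_le (h0 : 0 < q) (h1 : q < 1) (hq : 1 - q ≤ 1 / Real.exp 1) :
    ∫⁻ t in Set.Icc 0 1, ENNReal.ofReal (dualWeight q t) ≤ ENNReal.ofReal (1 / Real.exp 1) := by
  obtain ⟨a, ha, hza, hint⟩ := lintegral_dualWeight_threshold h0 h1 hq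
  have hsub : Set.Icc (0 : ℝ) 1 ⊆ Set.Ico 0 a ∪ Set.Icc a 1 := by
    intro t ht
    rcases lt_or_ge t a with h | h
    · exact Or.inl ⟨ht.1, h⟩
    · exact Or.inr ⟨h, ht.2⟩
  have hz : ∫⁻ t in Set.Ico 0 a, ENNReal.ofReal (dualWeight q t) = 0 := by
    rw [setLIntegral_congr_fun (g := fun _ => 0) measurableSet_Ico, lintegral_zero]
    intro t ht
    -- Before the threshold `1 + log z ≤ 0`, and the truncation takes the positive part.
    refine ENNReal.ofReal_of_nonpos (mul_nonpos_of_nonneg_of_nonpos h0.le ?_)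
    have h2 : 1 - q + q * t ≤ 1 / Real.exp 1 := by
      have := mul_le_mul_of_nonneg_left ht.2.le h0.le
      linarith
    have h3 := Real.log_le_log (geomScale_pos h0 h1 ht.1) h2
    rw [one_div, Real.log_inv, Real.log_exp] at h3
    linarith
  calc _ ≤ _ := lintegral_mono_set hsub
    _ ≤ _ := lintegral_union_le _ _ _
    _ = _ := by rw [hz, hint, zero_add]

/-- Stopping at a record gains no more than the dual weights provide. -/
theorem le_dualWeight_add (h0 : 0 < q) (h1 : q < 1) (hq : 1 - q ≤ 1 / Real.exp 1) {t : ℝ}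
    (ht : t ∈ Set.Icc (0 : ℝ) 1) :
    ENNReal.ofReal q ≤ ENNReal.ofReal (dualWeight q t) + ENNReal.ofReal (q / (1 - q + q * t)) *
      ∫⁻ s in Set.Icc t 1, ENNReal.ofReal (dualWeight q s) := by
  have hz := geomScale_pos h0 h1 ht.1
  rcases le_total (1 / Real.exp 1) (1 - q + q * t) with h | h
  -- After the threshold there is equality: `q (1 + log z) + (q / z) (-z log z) = q`.
  · rw [lintegral_dualWeight h0 h1 ht.1 ht.2 h, ← ENNReal.ofReal_mul (div_nonneg h0.le hz.le)]
    refine le_trans ?_ ENNReal.ofReal_add_le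
    refine ENNReal.ofReal_le_ofReal (le_of_eq ?_)
    unfold dualWeight
    field_simp
    ring
  -- Before the threshold the integral term suffices: it is at least `(q / z) / e`, and `z ≤ 1/e`.
  · obtain ⟨a, ha, hza, hint⟩ := lintegral_dualWeight_threshold h0 h1 hq
    have hta : t ≤ a := by
      rw [← hza] at h
      exact le_of_mul_le_mul_left (by linarith) h0
    calc ENNReal.ofReal q
        ≤ ENNReal.ofReal (q / (1 - q + q * t)) * ENNReal.ofReal (1 / Real.exp 1) := by
          rw [← ENNReal.ofReal_mul (div_nonneg h0.le hz.le)]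
          refine ENNReal.ofReal_le_ofReal ?_
          rw [div_mul_eq_mul_div, le_div_iff₀ hz]
          exact mul_le_mul_of_nonneg_left h h0.le
      _ ≤ ENNReal.ofReal (q / (1 - q + q * t)) *
            ∫⁻ s in Set.Icc t 1, ENNReal.ofReal (dualWeight q s) := by
          rw [← hint]
          gcongr
      _ ≤ _ := le_add_self

/-- Weak duality: integrate the constraint at `s` against the dual weight of `s`, exchange the
integrals by Tonelli, and compare pointwise using `le_dualWeight_add`. -/
theorem lintegral_stopping_bound (h0 : 0 < q) (h1 : q < 1) (hq : 1 - q ≤ 1 / Real.exp 1)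
    {φ : ℝ → ℝ≥0∞} (hφ : Measurable φ)
    (h : ∀ s ∈ Set.Icc (0 : ℝ) 1,
      φ s + ∫⁻ t in Set.Icc 0 s, ENNReal.ofReal (q / (1 - q + q * t)) * φ t ≤ 1) :
    ENNReal.ofReal q * ∫⁻ t in Set.Icc 0 1, φ t ≤ ENNReal.ofReal (1 / Real.exp 1) := by
  let w : ℝ → ℝ≥0∞ := fun s => ENNReal.ofReal (dualWeight q s)
  have hw : Measurable w := measurable_dualWeight.ennreal_ofReal
  let a : ℝ → ℝ≥0∞ := fun t => ENNReal.ofReal (q / (1 - q + q * t)) * φ t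
  have ha : Measurable a := by
    refine Measurable.mul (Measurable.ennreal_ofReal ?_) hφ
    fun_prop
  let f : ℝ → ℝ → ℝ≥0∞ := fun s t => {p : ℝ × ℝ | p.2 ≤ p.1}.indicator 1 (s, t) * (w s * a t)
  have hf : Measurable (Function.uncurry f) := by
    refine Measurable.mul (measurable_one.indicator (measurableSet_le measurable_snd measurable_fst))
      ?_
    exact (hw.comp measurable_fst).mul (ha.comp measurable_snd)
  have hf1 : ∀ s ∈ Set.Icc (0 : ℝ) 1,
      ∫⁻ t in Set.Icc 0 1, f s t = w s * ∫⁻ t in Set.Icc 0 s, a t := by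
    intro s hs
    have : ∀ t, f s t = (Set.Iic s).indicator (fun t => w s * a t) t := by
      intro t
      by_cases hts : t ≤ s <;> simp [f, hts]
    simp only [this]
    rw [lintegral_indicator measurableSet_Iic, Measure.restrict_restrict measurableSet_Iic,
      lintegral_const_mul _ ha]
    congr 3
    ext t
    simp only [Set.mem_inter_iff, Set.mem_Iic, Set.mem_Icc]
    exact ⟨fun h => ⟨h.2.1, h.1⟩, fun h => ⟨h.2, h.1, h.2.trans hs.2⟩⟩
  have hf2 : ∀ t ∈ Set.Icc (0 : ℝ) 1,
      ∫⁻ s in Set.Icc 0 1, f s t = (∫⁻ s in Set.Icc t 1, w s) * a t := by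
    intro t ht
    have : ∀ s, f s t = (Set.Ici t).indicator (fun s => w s * a t) s := by
      intro s
      by_cases hts : t ≤ s <;> simp [f, hts]
    simp only [this]
    rw [lintegral_indicator measurableSet_Ici, Measure.restrict_restrict measurableSet_Ici,
      lintegral_mul_const _ hw]
    congr 3
    ext s
    simp only [Set.mem_inter_iff, Set.mem_Ici, Set.mem_Icc]
    exact ⟨fun h => ⟨h.1, h.2.2⟩, fun h => ⟨h.1, ht.1.trans h.1, h.2⟩⟩
  calc ENNReal.ofReal q * ∫⁻ t in Set.Icc 0 1, φ t
      = ∫⁻ t in Set.Icc 0 1, ENNReal.ofReal q * φ t := (lintegral_const_mul _ hφ).symm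
    _ ≤ ∫⁻ t in Set.Icc 0 1, (w t * φ t + ∫⁻ s in Set.Icc 0 1, f s t) := by
        refine setLIntegral_mono' measurableSet_Icc fun t ht => ?_
        rw [hf2 t ht]
        calc _ ≤ _ := mul_le_mul_left (le_dualWeight_add h0 h1 hq ht) (φ t)
          _ = _ := by
            simp only [w, a]
            ring
    _ = (∫⁻ t in Set.Icc 0 1, w t * φ t) +
          ∫⁻ t in Set.Icc 0 1, ∫⁻ s in Set.Icc 0 1, f s t := lintegral_add_left (hw.mul hφ) _
    _ = (∫⁻ s in Set.Icc 0 1, w s * φ s) +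
          ∫⁻ s in Set.Icc 0 1, ∫⁻ t in Set.Icc 0 1, f s t := by
        rw [lintegral_lintegral_swap hf.aemeasurable]
    _ = ∫⁻ s in Set.Icc 0 1, (w s * φ s + ∫⁻ t in Set.Icc 0 1, f s t) :=
        (lintegral_add_left (hw.mul hφ) _).symm
    _ ≤ ∫⁻ s in Set.Icc 0 1, w s := by
        refine setLIntegral_mono' measurableSet_Icc fun s hs => ?_
        rw [hf1 s hs, ← mul_add]
        exact mul_le_of_le_one_right' (h s hs)
    _ ≤ _ := lintegral_dualWeight_zero_le h0 h1 hq

/-- The factor `1 / q` is the cost of excluding the case of no items, which has probability `1 - q`.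
-/
theorem winProb_geomPMF_le_one_div (h0 : 0 < q) (h1 : q < 1) (hq : 1 - q ≤ 1 / Real.exp 1)
    (τ : StoppingStrategy) :
    winProb τ (geomPMF h0 h1) ≤ ENNReal.ofReal (1 / Real.exp 1 / q) := by
  have h := lintegral_stopping_bound h0 h1 hq (measurable_stopRate τ)
    fun s hs => stopRate_add_lintegral_le h0 h1 τ hs
  rw [ENNReal.ofReal_div_of_pos h0, ENNReal.le_div_iff_mul_le (by simp [h0]) (by simp), mul_comm]
  exact (mul_le_mul_right (winProb_geomPMF_le h0 h1 τ) _).trans h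

end Duality

/-! ### The winning probabilities of the `x`-strategies -/

/-- Of the items that arrive between `x` and `t`, each one is preceded by a better item that arrives
before `x`. -/
def beforeRegion (x t : ℝ) (m : ℕ) : Set (Fin m → ℝ) :=
  {v | ∀ j, x ≤ v j → v j ≤ t → ∃ i < j, v i < x}

/-- The best item must come at `x` or later, with no record between `x` and its arrival. Every item
in between is therefore beaten by one from before `x`. -/
theorem mem_winEvent_xStrategy_iff {x : ℝ} {m : ℕ} {u : Fin (m + 1) → ℝ}
    (hu : Function.Injective u) :
    u ∈ winEvent (xStrategy x) (m + 1) ↔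
      x ≤ u 0 ∧ (fun i : Fin m => u i.succ) ∈ beforeRegion x (u 0) m := by
  have hmem : (fun i : Fin m => u i.succ) ∈ beforeRegion x (u 0) m ↔
      ∀ j : Fin m, x ≤ u j.succ → u j.succ ≤ u 0 → ∃ i < j, u i.succ < x := Iff.rfl
  rw [hmem]
  constructor
  · rintro ⟨k, hc, hr, hl⟩
    have h0 := itemAt_eq_zero_of_win hr hl
    have htk : arrivalTime u k = u 0 := congrArg u h0
    obtain ⟨⟨hx, -⟩, hfirst⟩ := (xChoice_eq_some_iff x _ _ _ k).1 hc
    rw [htk] at hx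
    refine ⟨hx, fun j hj1 hj2 => ?_⟩
    by_contra! hno
    classical
    have hex : ∃ i : Fin (m + 1), x ≤ u i ∧ u i < u 0 :=
      ⟨j.succ, hj1, lt_of_le_of_ne hj2 fun h => Fin.succ_ne_zero j (hu h)⟩
    -- The best item in `[x, u 0)` is at least as good as `j.succ`, so nothing before `x` beats it.
    -- It is then a record at which the strategy would have stopped.
    obtain ⟨i, ⟨hi1, hi2⟩, hmin⟩ := WellFounded.has_min (wellFounded_lt (α := Fin (m + 1)))
      {i | x ≤ u i ∧ u i < u 0} hex
    have hij : i ≤ j.succ := not_lt.1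
      (hmin j.succ ⟨hj1, lt_of_le_of_ne hj2 fun h => Fin.succ_ne_zero j (hu h)⟩)
    obtain ⟨p, rfl⟩ := exists_itemAt_eq u i
    have hpk : p < k := by
      rw [← (arrivalTime_strictMono hu).lt_iff_lt, htk]
      exact hi2
    refine hfirst p hpk ⟨hi1, (relRank_eq_one_iff_items hu p).2 fun i' hi' => ?_⟩
    by_contra! hle
    have hne : i' ≠ itemAt u p := fun h => hi'.ne (congrArg u h)
    have hlt : i' < itemAt u p := lt_of_le_of_ne hle hne
    have hi'x : u i' < x := by
      by_contra! hx'
      exact hmin i' ⟨hx', hi'.trans hi2⟩ hlt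
    have hi'0 : i' ≠ 0 := fun h => (hi'x.trans_le hx).ne (congrArg u h)
    obtain ⟨l, rfl⟩ := Fin.exists_succ_eq.2 hi'0
    exact (hno l (Fin.succ_lt_succ_iff.1 (hlt.trans_le hij))).not_gt hi'x
  · rintro ⟨hx, h⟩
    obtain ⟨k, hk⟩ := exists_itemAt_eq u 0
    have htk : arrivalTime u k = u 0 := congrArg u hk
    have hr : relRank u k = 1 := (relRank_eq_one_iff u k).2 fun j hj => by
      rw [hk, Fin.pos_iff_ne_zero]
      exact fun h0 => hj.ne ((Tuple.sort u).injective (h0.trans hk.symm))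
    refine ⟨k, (xChoice_eq_some_iff x _ _ _ k).2 ⟨⟨htk.symm ▸ hx, hr⟩, ?_⟩, hr, fun j hj => ?_⟩
    · rintro j hj ⟨hxj, hrj⟩
      have hj0 : itemAt u j ≠ 0 := fun h0 =>
        hj.ne ((Tuple.sort u).injective (h0.trans hk.symm))
      obtain ⟨l, hl⟩ := Fin.exists_succ_eq.2 hj0
      have hlt : arrivalTime u j < u 0 := htk ▸ arrivalTime_strictMono hu hj
      have hjl : arrivalTime u j = u l.succ := congrArg u hl.symm
      rw [hjl] at hxj hlt
      obtain ⟨i, hil, hix⟩ := h l hxj hlt.le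
      have := (relRank_eq_one_iff_items hu j).1 hrj i.succ (by
        rw [hjl]
        exact hix.trans_le hxj)
      rw [← hl] at this
      exact this.not_gt (Fin.succ_lt_succ_iff.2 hil)
    · refine lt_of_le_of_ne (relRank_pos u j) fun h1 => ?_
      have := (relRank_eq_one_iff u j).1 h1.symm k hj
      rw [hk] at this
      exact absurd this (Fin.not_lt_zero _)

theorem measurableSet_beforeRegion_prod (x : ℝ) (m : ℕ) :
    MeasurableSet {p : ℝ × (Fin m → ℝ) | p.2 ∈ beforeRegion x p.1 m} := by
  have : {p : ℝ × (Fin m → ℝ) | p.2 ∈ beforeRegion x p.1 m} =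
      ⋂ j, ({p : ℝ × (Fin m → ℝ) | x ≤ p.2 j}ᶜ ∪ {p : ℝ × (Fin m → ℝ) | p.2 j ≤ p.1}ᶜ ∪
        ⋃ i, ⋃ _ : i < j, {p : ℝ × (Fin m → ℝ) | p.2 i < x}) := by
    ext p
    simp only [Set.mem_iInter, Set.mem_union, Set.mem_iUnion, Set.mem_compl_iff, exists_prop]
    refine forall_congr' fun j => ?_
    show (x ≤ p.2 j → p.2 j ≤ p.1 → ∃ i < j, p.2 i < x) ↔
      ((¬ x ≤ p.2 j) ∨ ¬ p.2 j ≤ p.1) ∨ ∃ i < j, p.2 i < x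
    tauto
  rw [this]
  refine .iInter fun j => .union (.union ?_ ?_) (.iUnion fun i => .iUnion fun _ => ?_)
  · exact (measurableSet_le measurable_const (by fun_prop)).compl
  · exact (measurableSet_le (by fun_prop) measurable_fst).compl
  · exact measurableSet_lt (by fun_prop) measurable_const

theorem measurableSet_beforeRegion (x t : ℝ) (m : ℕ) : MeasurableSet (beforeRegion x t m) :=
  (measurableSet_beforeRegion_prod x m).preimage measurable_prodMk_left

/-- The probability of `beforeRegion`. -/
noncomputable def beforeProb (x t : ℝ) (m : ℕ) : ℝ :=
  x * ∑ i ∈ Finset.range m, (1 - t) ^ i + (1 - t) ^ m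

theorem beforeProb_nonneg {x t : ℝ} (hx : 0 ≤ x) (ht : t ≤ 1) (m : ℕ) : 0 ≤ beforeProb x t m := by
  have := sub_nonneg.2 ht
  unfold beforeProb
  positivity

/-- Condition on the best of the items: before `x` it settles the matter, in `[x, t]` it is fatal,
and after `t` it is irrelevant. Hence `P (m + 1) = x + (1 - t) P m`. -/
theorem arrivalLaw_beforeRegion {x t : ℝ} (hx : 0 ≤ x) (hxt : x ≤ t) (ht : t ≤ 1) (m : ℕ) :
    arrivalLaw m (beforeRegion x t m) = ENNReal.ofReal (beforeProb x t m) := by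
  induction m with
  | zero =>
    have : beforeRegion x t 0 = Set.univ := Set.eq_univ_of_forall fun v j => j.elim0
    rw [this, measure_univ]
    simp [beforeProb]
  | succ m ih =>
    have hst : 0 ≤ 1 - t := sub_nonneg.2 ht
    let A : Set (ℝ × (Fin m → ℝ)) :=
      Set.Iio x ×ˢ Set.univ ∪ Set.Ioi t ×ˢ beforeRegion x t m
    have hA : beforeRegion x t (m + 1) =
        (fun w : Fin (m + 1) → ℝ => (w 0, fun i : Fin m => w i.succ)) ⁻¹' A := by
      ext w
      constructor
      · intro h
        rcases lt_or_ge (w 0) x with hw | hw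
        · exact Or.inl ⟨hw, trivial⟩
        · have hwt : t < w 0 := by
            by_contra! hle
            obtain ⟨i, hi, -⟩ := h 0 hw hle
            exact absurd hi (Fin.not_lt_zero i)
          refine Or.inr ⟨hwt, fun j h1 h2 => ?_⟩
          obtain ⟨i, hi, hix⟩ := h j.succ h1 h2
          have hi0 : i ≠ 0 := by
            rintro rfl
            exact hix.not_ge hw
          obtain ⟨l, rfl⟩ := Fin.exists_succ_eq.2 hi0
          exact ⟨l, Fin.succ_lt_succ_iff.1 hi, hix⟩
      · rintro (⟨hw, -⟩ | ⟨hw, h⟩) j h1 h2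
        · have hw : w 0 < x := hw
          refine ⟨0, ?_, hw⟩
          rw [Fin.pos_iff_ne_zero]
          rintro rfl
          exact hw.not_ge h1
        · have hw : t < w 0 := hw
          have hj0 : j ≠ 0 := by
            rintro rfl
            exact hw.not_ge h2
          obtain ⟨l, rfl⟩ := Fin.exists_succ_eq.2 hj0
          obtain ⟨i, hi, hix⟩ := h l h1 h2
          exact ⟨i.succ, Fin.succ_lt_succ_iff.2 hi, hix⟩
    have hAm : MeasurableSet (Set.Ioi t ×ˢ beforeRegion x t m) :=
      measurableSet_Ioi.prod (measurableSet_beforeRegion x t m)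
    have hA1 : MeasurableSet (Set.Iio x ×ˢ (Set.univ : Set (Fin m → ℝ))) :=
      measurableSet_Iio.prod .univ
    rw [hA, (measurePreserving_arrivalLaw_succ m).measure_preimage
      (hA1.union hAm).nullMeasurableSet, measure_union _ hAm, Measure.prod_prod,
      Measure.prod_prod, ih, measure_univ, mul_one]
    · have h1 : (volume.restrict (Set.Icc (0 : ℝ) 1)) (Set.Iio x) = ENNReal.ofReal x := by
        rw [Measure.restrict_apply measurableSet_Iio]
        have : Set.Iio x ∩ Set.Icc 0 1 = Set.Ico 0 x := by
          ext y
          simp only [Set.mem_inter_iff, Set.mem_Iio, Set.mem_Icc, Set.mem_Ico]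
          exact ⟨fun h => ⟨h.2.1, h.1⟩, fun h => ⟨h.2, h.1, h.2.le.trans (hxt.trans ht)⟩⟩
        rw [this, Real.volume_Ico, sub_zero]
      have h2 : (volume.restrict (Set.Icc (0 : ℝ) 1)) (Set.Ioi t) = ENNReal.ofReal (1 - t) := by
        rw [Measure.restrict_apply measurableSet_Ioi]
        have : Set.Ioi t ∩ Set.Icc 0 1 = Set.Ioc t 1 := by
          ext y
          simp only [Set.mem_inter_iff, Set.mem_Ioi, Set.mem_Icc, Set.mem_Ioc]
          exact ⟨fun h => ⟨h.1, h.2.2⟩, fun h => ⟨h.1, (hx.trans hxt).trans h.1.le, h.2⟩⟩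
        rw [this, Real.volume_Ioc]
      rw [h1, h2, ← ENNReal.ofReal_mul hst,
        ← ENNReal.ofReal_add hx (mul_nonneg hst (beforeProb_nonneg hx ht m))]
      congr 1
      unfold beforeProb
      rw [Finset.sum_range_succ', pow_succ]
      simp only [pow_succ, ← Finset.sum_mul]
      ring
    · rw [Set.disjoint_left]
      rintro p ⟨h1, -⟩ ⟨h2, -⟩
      exact ((Set.mem_Iio.1 h1).trans_le hxt).not_gt h2

/-- The winning probability of the `x`-strategy when there are `m + 1` items. -/
noncomputable def xWin (m : ℕ) (x : ℝ) : ℝ :=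
  x * ∑ i ∈ Finset.range m, (1 - x) ^ (i + 1) / (i + 1) + (1 - x) ^ (m + 1) / (m + 1)

theorem xWin_nonneg {x : ℝ} (hx : x ∈ Set.Icc (0 : ℝ) 1) (m : ℕ) : 0 ≤ xWin m x := by
  have h1 := hx.1
  have := sub_nonneg.2 hx.2
  unfold xWin
  positivity

theorem integral_one_sub_pow (x : ℝ) (i : ℕ) :
    ∫ t in x..1, (1 - t) ^ i = (1 - x) ^ (i + 1) / (i + 1) := by
  rw [intervalIntegral.integral_comp_sub_left (fun t => t ^ i) 1]
  simp

theorem integral_beforeProb (x : ℝ) (m : ℕ) : ∫ t in x..1, beforeProb x t m = xWin m x := by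
  have hi : ∀ i, IntervalIntegrable (fun t : ℝ => (1 - t) ^ i) volume x 1 := fun i =>
    Continuous.intervalIntegrable (by fun_prop) _ _
  unfold beforeProb xWin
  rw [intervalIntegral.integral_add (Continuous.intervalIntegrable (by fun_prop) _ _) (hi m),
    intervalIntegral.integral_const_mul, intervalIntegral.integral_finsetSum fun i _ => hi i]
  simp only [integral_one_sub_pow]

theorem winProbAt_xStrategy {x : ℝ} (hx : x ∈ Set.Icc (0 : ℝ) 1) (m : ℕ) :
    winProbAt (xStrategy x) (m + 1) = ENNReal.ofReal (xWin m x) := by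
  let A : Set (ℝ × (Fin m → ℝ)) := Prod.fst ⁻¹' Set.Ici x ∩ {p | p.2 ∈ beforeRegion x p.1 m}
  have hA : MeasurableSet A :=
    (measurableSet_Ici.preimage measurable_fst).inter (measurableSet_beforeRegion_prod x m)
  have h1 : winProbAt (xStrategy x) (m + 1) = arrivalLaw (m + 1)
      ((fun w : Fin (m + 1) → ℝ => (w 0, fun i : Fin m => w i.succ)) ⁻¹' A) := by
    refine measure_congr ?_
    filter_upwards [ae_injective_arrivalLaw (m + 1)] with u hu
    exact propext (mem_winEvent_xStrategy_iff hu)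
  rw [h1, (measurePreserving_arrivalLaw_succ m).measure_preimage hA.nullMeasurableSet,
    Measure.prod_apply hA]
  have h2 : ∀ t ∈ Set.Icc (0 : ℝ) 1, arrivalLaw m (Prod.mk t ⁻¹' A) =
      (Set.Ici x).indicator (fun t => ENNReal.ofReal (beforeProb x t m)) t := by
    intro t ht
    by_cases hxt : x ≤ t
    · rw [Set.indicator_of_mem (Set.mem_Ici.2 hxt), ← arrivalLaw_beforeRegion hx.1 hxt ht.2]
      congr 1
      ext v
      exact ⟨fun h => h.2, fun h => ⟨hxt, h⟩⟩
    · rw [Set.indicator_of_notMem (by simpa using hxt)]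
      convert measure_empty (μ := arrivalLaw m)
      ext v
      simp only [Set.mem_empty_iff_false, iff_false]
      exact fun h => hxt h.1
  rw [setLIntegral_congr_fun measurableSet_Icc h2, lintegral_indicator measurableSet_Ici,
    Measure.restrict_restrict measurableSet_Ici]
  have h3 : Set.Ici x ∩ Set.Icc 0 1 = Set.Icc x 1 := by
    ext t
    simp only [Set.mem_inter_iff, Set.mem_Ici, Set.mem_Icc]
    exact ⟨fun h => ⟨h.1, h.2.2⟩, fun h => ⟨h.1, hx.1.trans h.1, h.2⟩⟩
  have hc : Continuous fun t => beforeProb x t m := by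
    unfold beforeProb
    fun_prop
  rw [h3, ← integral_beforeProb, intervalIntegral.integral_of_le hx.2,
    ← integral_Icc_eq_integral_Ioc, ofReal_integral_eq_lintegral_ofReal
      hc.continuousOn.integrableOn_Icc]
  exact (ae_restrict_iff' measurableSet_Icc).2
    (Filter.Eventually.of_forall fun t ht => beforeProb_nonneg hx.1 ht.2 m)

/-! ### Dependence of `xWin` on the number of items -/

open Filter Topology in
theorem tendsto_xWin {x : ℝ} (h0 : 0 < x) (h1 : x < 1) :
    Tendsto (fun m => xWin m x) atTop (𝓝 (-(x * Real.log x))) := by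
  have ha : |1 - x| < 1 := by
    rw [abs_lt]
    constructor <;> linarith
  have h := Real.hasSum_pow_div_log_of_abs_lt_one ha
  rw [sub_sub_cancel] at h
  have h2 := ((h.tendsto_sum_nat).const_mul x).add h.summable.tendsto_atTop_zero
  rw [add_zero, mul_neg] at h2
  exact h2

theorem xWin_strictAnti {x : ℝ} (h1 : x < 1) : StrictAnti fun m => xWin m x := by
  refine strictAnti_nat_of_succ_lt fun m => ?_
  have h2 : xWin m x - xWin (m + 1) x =
      (1 - x) ^ (m + 2) * (1 / ((m : ℝ) + 1) - 1 / ((m : ℝ) + 2)) := by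
    unfold xWin
    rw [Finset.sum_range_succ]
    push_cast
    have : (m : ℝ) + 1 + 1 = m + 2 := by ring
    rw [this]
    field_simp
    ring
  have h3 : 1 / ((m : ℝ) + 2) < 1 / ((m : ℝ) + 1) :=
    one_div_lt_one_div_of_lt (by positivity) (by linarith)
  have h4 := mul_pos (pow_pos (sub_pos.2 h1) (m + 2)) (sub_pos.2 h3)
  linarith

/-- The limit is compared with the term at `m + 1`, which leaves room for strictness at `m`. -/
theorem neg_mul_log_lt_xWin {x : ℝ} (h0 : 0 < x) (h1 : x < 1) (m : ℕ) :
    -(x * Real.log x) < xWin m x :=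
  ((xWin_strictAnti h1).antitone.le_of_tendsto (tendsto_xWin h0 h1) (m + 1)).trans_lt
    (xWin_strictAnti h1 m.lt_succ_self)

/-- The derivative of `xWin m`. -/
noncomputable def xSlope (m : ℕ) (x : ℝ) : ℝ :=
  ∑ i ∈ Finset.range m, (1 - x) ^ (i + 1) / (i + 1) - 1

theorem hasDerivAt_xWin (m : ℕ) (x : ℝ) : HasDerivAt (xWin m) (xSlope m x) x := by
  have hp : ∀ i : ℕ, HasDerivAt (fun x : ℝ => (1 - x) ^ (i + 1) / ((i : ℝ) + 1))
      (-(1 - x) ^ i) x := by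
    intro i
    have h := (((hasDerivAt_id x).const_sub 1).pow (i + 1)).div_const ((i : ℝ) + 1)
    refine h.congr_deriv ?_
    have : (i : ℝ) + 1 ≠ 0 := by positivity
    simp only [id, Nat.cast_add, Nat.cast_one, add_tsub_cancel_right]
    field_simp
  have hs : HasDerivAt (fun x : ℝ => ∑ i ∈ Finset.range m, (1 - x) ^ (i + 1) / ((i : ℝ) + 1))
      (∑ i ∈ Finset.range m, -(1 - x) ^ i) x := HasDerivAt.fun_sum fun i _ => hp i
  refine (((hasDerivAt_id x).mul hs).add (hp m)).congr_deriv ?_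
  have hg := geom_sum_mul (1 - x) m
  rw [Finset.sum_neg_distrib]
  unfold xSlope
  simp only [id]
  linear_combination hg

theorem xSlope_antitone (m : ℕ) : AntitoneOn (xSlope m) (Set.Iic 1) := by
  intro x hx y hy hxy
  have hy' : 0 ≤ 1 - y := sub_nonneg.2 hy
  unfold xSlope
  gcongr

/-- Concavity: by the mean value theorem the chord has slope at most that at its left end. -/
theorem xWin_sub_ge (m : ℕ) {x d : ℝ} (hxd : x < d) (hd : d ≤ 1) :
    xWin m d + (d - x) * -xSlope m x ≤ xWin m x := by
  obtain ⟨y, hy, h⟩ := exists_hasDerivAt_eq_slope (xWin m) (xSlope m) hxd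
    (fun z _ => (hasDerivAt_xWin m z).continuousAt.continuousWithinAt)
    fun z _ => hasDerivAt_xWin m z
  have hle : xSlope m y ≤ xSlope m x :=
    xSlope_antitone m (hxd.le.trans hd) (hy.2.le.trans hd) hy.1.le
  have hpos := sub_pos.2 hxd
  rw [eq_div_iff hpos.ne'] at h
  have := mul_le_mul_of_nonneg_right hle hpos.le
  linarith

/-- The sum in `xSlope` is a partial sum of the series of `-log x`, whose terms are positive. The
bound vanishes at `x = 1/e`. -/
theorem xSlope_lt {x : ℝ} (h0 : 0 < x) (h1 : x < 1) (m : ℕ) : xSlope m x < -Real.log x - 1 := by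
  have ha : |1 - x| < 1 := by
    rw [abs_lt]
    constructor <;> linarith
  have h := Real.hasSum_pow_div_log_of_abs_lt_one ha
  rw [sub_sub_cancel] at h
  have hx := sub_pos.2 h1
  have h2 := sum_le_hasSum (Finset.range (m + 1)) (fun i _ => by positivity) h
  rw [Finset.sum_range_succ] at h2
  have h3 : 0 < (1 - x) ^ (m + 1) / ((m : ℝ) + 1) := by positivity
  unfold xSlope
  linarith

/-! ### The conclusions -/

theorem one_div_exp_pos : 0 < 1 / Real.exp 1 := by positivity

theorem one_div_exp_lt_one : 1 / Real.exp 1 < 1 := by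
  rw [div_lt_one (Real.exp_pos 1)]
  exact Real.one_lt_exp_iff.2 one_pos

theorem winProbAt_xStrategy_pnat {x : ℝ} (hx : x ∈ Set.Icc (0 : ℝ) 1) (n : ℕ+) :
    winProbAt (xStrategy x) n = ENNReal.ofReal (xWin n.natPred x) := by
  rw [← winProbAt_xStrategy hx, PNat.natPred_add_one]

theorem winProb_le_one (ν : PMF ℕ+) (τ : StoppingStrategy) : winProb τ ν ≤ 1 := by
  rw [← ν.tsum_coe]
  exact ENNReal.tsum_le_tsum fun n => mul_le_of_le_one_right' prob_le_one

theorem one_div_exp_lt_winProb (ν : PMF ℕ+) :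
    ENNReal.ofReal (1 / Real.exp 1) < winProb (xStrategy (1 / Real.exp 1)) ν := by
  have hlt : ∀ n : ℕ+, ENNReal.ofReal (1 / Real.exp 1) <
      winProbAt (xStrategy (1 / Real.exp 1)) n := by
    intro n
    rw [winProbAt_xStrategy_pnat ⟨one_div_exp_pos.le, one_div_exp_lt_one.le⟩]
    have h := neg_mul_log_lt_xWin one_div_exp_pos one_div_exp_lt_one n.natPred
    rw [one_div_exp_mul_log] at h
    exact (ENNReal.ofReal_lt_ofReal_iff_of_nonneg one_div_exp_pos.le).2 h
  obtain ⟨n, hn⟩ := ν.support_nonempty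
  have hsum : ∑' n : ℕ+, ν n * ENNReal.ofReal (1 / Real.exp 1) =
      ENNReal.ofReal (1 / Real.exp 1) := by
    rw [ENNReal.tsum_mul_right, ν.tsum_coe, one_mul]
  rw [← hsum]
  refine ENNReal.tsum_lt_tsum (i := n) ?_ (fun n => mul_le_mul_right (hlt n).le _) ?_
  · rw [hsum]
    exact ENNReal.ofReal_ne_top
  · exact ENNReal.mul_lt_mul_right ((ν.mem_support_iff n).1 hn) (ν.apply_ne_top n) (hlt n)

-- Fix one `n` in the support. Moving from `d = 1/e` to `x < d` gains at least `(d - x) (-xSlope m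
-- x)` at `n` and loses at most `(d - x) δ` elsewhere, where `δ = -log x - 1` tends to `0` as `x →
-- d`. No differentiation under the sum over `n` is needed.
open Filter Topology in
theorem exists_winProb_xStrategy_gt (ν : PMF ℕ+) : ∃ x ∈ Set.Icc (0 : ℝ) 1,
    winProb (xStrategy (1 / Real.exp 1)) ν < winProb (xStrategy x) ν := by
  set d := 1 / Real.exp 1 with hd
  have hd0 : 0 < d := one_div_exp_pos
  have hd1 : d < 1 := one_div_exp_lt_one
  have hlogd : -Real.log d - 1 = 0 := by
    rw [hd, one_div, Real.log_inv, Real.log_exp]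
    ring
  obtain ⟨n, hn⟩ := ν.support_nonempty
  have hn0 : ν n ≠ 0 := (ν.mem_support_iff n).1 hn
  have hp : 0 < (ν n).toReal := ENNReal.toReal_pos hn0 (ν.apply_ne_top n)
  set m := n.natPred with hm
  have hsd : xSlope m d < 0 := by
    have := xSlope_lt hd0 hd1 m
    linarith
  have hcs : ContinuousAt (xSlope m) d := by
    unfold xSlope
    fun_prop
  have hcl : ContinuousAt (fun x => -Real.log x - 1) d :=
    ((Real.continuousAt_log hd0.ne').neg).sub continuousAt_const
  -- At `x = d` the left side is `0` and the right side is positive.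
  have hev : ∀ᶠ x in 𝓝 d, -Real.log x - 1 < (ν n).toReal * -xSlope m x := by
    refine hcl.eventually_lt (continuousAt_const.mul hcs.neg) ?_
    simp only [hlogd]
    exact mul_pos hp (neg_pos.2 hsd)
  have hev2 : ∀ᶠ x in 𝓝 d, xSlope m x < 0 := hcs.eventually_lt_const hsd
  obtain ⟨x, ⟨hx1, hx2, hx0⟩, hxd⟩ := ((hev.and (hev2.and (lt_mem_nhds hd0))).filter_mono
    (nhdsWithin_le_nhds (s := Set.Iio d))).and (self_mem_nhdsWithin) |>.exists
  have hxd : x < d := hxd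
  have hx : x ∈ Set.Icc (0 : ℝ) 1 := ⟨hx0.le, (hxd.trans hd1).le⟩
  refine ⟨x, hx, ?_⟩
  set δ := -Real.log x - 1 with hδ
  have hδ0 : 0 ≤ δ := by
    have := Real.log_le_log hx0 hxd.le
    linarith
  have hdx := sub_pos.2 hxd
  let g : ℕ+ → ℝ≥0∞ := fun k => if k = n then ENNReal.ofReal ((d - x) * -xSlope m x) else 0
  have hterm : ∀ k : ℕ+, winProbAt (xStrategy d) k + g k ≤
      winProbAt (xStrategy x) k + ENNReal.ofReal ((d - x) * δ) := by
    intro k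
    rw [winProbAt_xStrategy_pnat hx, winProbAt_xStrategy_pnat ⟨hd0.le, hd1.le⟩,
      ← ENNReal.ofReal_add (xWin_nonneg hx _) (mul_nonneg hdx.le hδ0)]
    have h1 := xWin_sub_ge k.natPred hxd hd1.le
    have h2 := mul_nonneg hdx.le hδ0
    by_cases hk : k = n
    · subst hk
      simp only [g, if_true]
      rw [← ENNReal.ofReal_add (xWin_nonneg ⟨hd0.le, hd1.le⟩ _)
        (mul_nonneg hdx.le (neg_nonneg.2 hx2.le))]
      exact ENNReal.ofReal_le_ofReal (by linarith)
    · simp only [g, hk, if_false, add_zero]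
      refine ENNReal.ofReal_le_ofReal ?_
      have h3 := xSlope_lt hx0 (hxd.trans hd1) k.natPred
      have h4 := mul_le_mul_of_nonneg_left h3.le hdx.le
      linarith
  have hsum : winProb (xStrategy d) ν + ν n * ENNReal.ofReal ((d - x) * -xSlope m x) ≤
      winProb (xStrategy x) ν + ENNReal.ofReal ((d - x) * δ) := by
    have h1 : ∑' k, ν k * g k = ν n * ENNReal.ofReal ((d - x) * -xSlope m x) := by
      rw [tsum_eq_single n]
      · simp [g]
      · intro k hk
        simp [g, hk]
    have h2 : ∑' k : ℕ+, ν k * ENNReal.ofReal ((d - x) * δ) = ENNReal.ofReal ((d - x) * δ) := by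
      rw [ENNReal.tsum_mul_right, ν.tsum_coe, one_mul]
    rw [← h1, ← h2, winProb, winProb, ← ENNReal.tsum_add, ← ENNReal.tsum_add]
    simp only [← mul_add]
    exact ENNReal.tsum_le_tsum fun k => mul_le_mul_right (hterm k) _
  have hlt : ENNReal.ofReal ((d - x) * δ) < ν n * ENNReal.ofReal ((d - x) * -xSlope m x) := by
    rw [← ENNReal.ofReal_toReal (ν.apply_ne_top n), ← ENNReal.ofReal_mul hp.le]
    refine (ENNReal.ofReal_lt_ofReal_iff_of_nonneg (mul_nonneg hdx.le hδ0)).2 ?_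
    have := mul_lt_mul_of_pos_left hx1 hdx
    linarith
  have hfin : winProb (xStrategy d) ν ≠ ∞ :=
    ne_top_of_le_ne_top ENNReal.one_ne_top (winProb_le_one ν _)
  by_contra! hle
  exact (lt_irrefl _) (((ENNReal.add_lt_add_left hfin hlt).trans_le hsum).trans_le
    (add_le_add_left hle _))

/-! ### Value, minimax strategies and saddle points in a general game -/

section Games

variable {A B : Type*} {W : A → B → ℝ≥0∞} {v : ℝ≥0∞}

theorem lowerValue_le_upperValue (W : A → B → ℝ≥0∞) : lowerValue W ≤ upperValue W :=
  iSup_le fun a => le_iInf fun b => (iInf_le _ b).trans (le_iSup (fun a => W a b) a)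

theorem hasValue_of_le {a₀ : A} (h : ∀ b, v ≤ W a₀ b) (hu : upperValue W ≤ v) : HasValue W v := by
  have hl : v ≤ lowerValue W := (le_iInf h).trans (le_iSup (fun a => ⨅ b, W a b) a₀)
  exact ⟨(lowerValue_le_upperValue W |>.trans hu).antisymm hl,
    hu.antisymm (hl.trans (lowerValue_le_upperValue W))⟩

theorem not_exists_isMinimax {a₀ : A} (h : ∀ b, v < W a₀ b) (hu : upperValue W ≤ v) :
    ¬ ∃ b, IsMinimax W b := fun ⟨b, hb⟩ =>
  ((h b).trans_le (le_iSup (fun a => W a b) a₀)).not_ge ((le_iInf hb).trans hu)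

/-- In a saddle point `b` is minimax: `sup W · b ≤ W a b ≤ W a b' ≤ sup W · b'`. -/
theorem not_exists_isSaddlePoint {a₀ : A} (h : ∀ b, v < W a₀ b) (hu : upperValue W ≤ v) :
    ¬ ∃ a b, IsSaddlePoint W a b := fun ⟨a, b, hs⟩ =>
  not_exists_isMinimax h hu ⟨b, fun b' =>
    (iSup_le hs.1).trans ((hs.2 b').trans (le_iSup (fun a => W a b') a))⟩

end Games

/-- The randomized strategy that ignores the seed. -/
def StoppingStrategy.toRandomized (τ : StoppingStrategy) : RandomizedStrategy where
  strategy _ := τ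
  measurable_strategy n k := (τ.measurable_choice n k).preimage measurable_snd

theorem randomizedWinProb_toRandomized (τ : StoppingStrategy) (ν : PMF ℕ+) :
    randomizedWinProb τ.toRandomized ν = winProb τ ν := by
  simp [randomizedWinProb, StoppingStrategy.toRandomized]

theorem randomizedWinProb_le {ν : PMF ℕ+} {c : ℝ≥0∞} (h : ∀ τ, winProb τ ν ≤ c)
    (σ : RandomizedStrategy) : randomizedWinProb σ ν ≤ c := by
  calc randomizedWinProb σ ν ≤ ∫⁻ _ in Set.Icc (0 : ℝ) 1, c := lintegral_mono fun s => h _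
    _ = c := by simp

-- The set `A` is left general so that pure and randomized strategies are treated at once; `h` says
-- that bounds valid for all pure strategies carry over to `A`.
open Filter Topology in
theorem upperValue_le_of_geomPMF {A : Type*} {W : A → PMF ℕ+ → ℝ≥0∞}
    (h : ∀ (ν : PMF ℕ+) (c : ℝ≥0∞), (∀ τ, winProb τ ν ≤ c) → ∀ a, W a ν ≤ c) :
    upperValue W ≤ ENNReal.ofReal (1 / Real.exp 1) := by
  have ht : Tendsto (fun q : ℝ => ENNReal.ofReal (1 / Real.exp 1 / q)) (𝓝[<] 1)
      (𝓝 (ENNReal.ofReal (1 / Real.exp 1))) := by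
    have hc : ContinuousAt (fun q : ℝ => 1 / Real.exp 1 / q) 1 :=
      continuousAt_const.div continuousAt_id one_ne_zero
    have := (ENNReal.continuous_ofReal.continuousAt.comp hc).tendsto
    simp only [Function.comp_def, div_one] at this
    exact this.mono_left nhdsWithin_le_nhds
  refine ge_of_tendsto ht ?_
  have h1 : ∀ᶠ q : ℝ in 𝓝[<] 1, 1 - 1 / Real.exp 1 < q :=
    nhdsWithin_le_nhds (lt_mem_nhds (by linarith [one_div_exp_pos]))
  filter_upwards [h1, self_mem_nhdsWithin] with q hq hq1
  have hq1 : q < 1 := hq1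
  have hq0 : 0 < q := by linarith [one_div_exp_lt_one]
  exact (iInf_le _ (geomPMF hq0 hq1)).trans (iSup_le fun a => h _ _
    (fun τ => winProb_geomPMF_le_one_div hq0 hq1 (by linarith) τ) a)

theorem corollary3 :
    -- the value of the game is `1/e`, with or without randomization on Alice's side
    (HasValue winProb (ENNReal.ofReal (1 / Real.exp 1)) ∧
      HasValue randomizedWinProb (ENNReal.ofReal (1 / Real.exp 1))) ∧
    -- Pierre has no minimax strategy
    ((¬ ∃ ν : PMF ℕ+, IsMinimax winProb ν) ∧
      ¬ ∃ ν : PMF ℕ+, IsMinimax randomizedWinProb ν) ∧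
    -- there is no saddle point
    ((¬ ∃ (τ : StoppingStrategy) (ν : PMF ℕ+), IsSaddlePoint winProb τ ν) ∧
      ¬ ∃ (σ : RandomizedStrategy) (ν : PMF ℕ+), IsSaddlePoint randomizedWinProb σ ν) ∧
    -- the `1/e`-strategy is never optimal: some `x`-strategy does strictly better
    ∀ ν : PMF ℕ+, ¬ IsOptimalAgainst ν (xStrategy (1 / Real.exp 1)) ∧
      ∃ x ∈ Set.Icc (0 : ℝ) 1, winProb (xStrategy (1 / Real.exp 1)) ν < winProb (xStrategy x) ν := by
  have hw : upperValue winProb ≤ ENNReal.ofReal (1 / Real.exp 1) :=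
    upperValue_le_of_geomPMF fun _ _ h => h
  have hr : upperValue randomizedWinProb ≤ ENNReal.ofReal (1 / Real.exp 1) :=
    upperValue_le_of_geomPMF fun _ _ h => randomizedWinProb_le h
  have hwl := one_div_exp_lt_winProb
  have hrl : ∀ ν, ENNReal.ofReal (1 / Real.exp 1) <
      randomizedWinProb (xStrategy (1 / Real.exp 1)).toRandomized ν := fun ν => by
    rw [randomizedWinProb_toRandomized]
    exact hwl ν
  refine ⟨⟨hasValue_of_le (fun ν => (hwl ν).le) hw, hasValue_of_le (fun ν => (hrl ν).le) hr⟩,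
    ⟨not_exists_isMinimax hwl hw, not_exists_isMinimax hrl hr⟩,
    ⟨not_exists_isSaddlePoint hwl hw, not_exists_isSaddlePoint hrl hr⟩, fun ν => ?_⟩
  obtain ⟨x, hx, h⟩ := exists_winProb_xStrategy_gt ν
  exact ⟨fun hopt => (hopt (xStrategy x)).not_gt h, x, hx, h⟩
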